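/- Conventions. A geodesic metric space is $1$-hyperbolic if for all points $p,q,r$ and all geodesic segments $[p,q],[p,r],[q,r]$, the segment $[p,q]$ lies in the $1$-neighbourhood of $[p,r]\cup[q,r]$. Let a group $G$ act by isometries on such a space $(X,d)$, and let $x\in X$. For $g\in G$ put $|g|_x=d(x,gx)$ and $\|g\|=\inf_{y\in X}d(y,gy)$. Two $n$-tuples in $G^n$ are Nielsen-equivalent if one is obtained from the other by finitely many moves of the form: replace some $g_i$ by $g_i^{-1}$; replace $g_i$ by $g_ig_j$ for some $j\ne i$; interchange $g_i$ and $g_j$ for some $i\neq j$. A tuple $M=(g_1,\dots,g_n)$ is minimal (with respect to $x$) if $\sum_i|g_i|_x\le 1+\sum_i|g'_i|_x$ for every tuple $(g'_1,\dots,g'_n)$ Nielsen-equivalent to $M$. Theorem. Let $n\ge 1$ be an integer and let $c>0$. There are positive integers $d_1=d_1(n,c)$, $d_2=d_2(n)$, $d_3=d_3(n)$, $d_4=d_4(n,c)$, where $d_2$ and $d_3$ do not depend on $c$, such that the following holds for every $1$-hyperbolic geodesic metric space $X$, every group $G$ acting on $X$ by isometries, every $x\in X$ and every minimal $n$-tuple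 $M=(g_1,\dots,g_n)\in G^n$. Either $M$ is Nielsen-equivalent to a tuple $(g'_1,\dots,g'_n)$ with $\|g'_1\|\le d_1$, or the subgroup $U=\langle M\rangle\le G$ is freely generated by $M$ and: (1) the map $U\to X$, $u\mapsto ux$, is a quasi-isometric embedding, where $U$ carries the free group word metric with respect to $M$; (2) for every $u=g_{i_1}^{\epsilon_1}\cdots g_{i_k}^{\epsilon_k}\in U$ (with $k\ge1$, $\epsilon_j=\pm1$, the word not necessarily reduced), every geodesic segment $[x,ux]$ lies in the $d_2$-neighbourhood of $$[x,g_{i_1}^{\epsilon_1}x]\cup g_{i_1}^{\epsilon_1}[x,g_{i_2}^{\epsilon_2}x]\cup\cdots\cup g_{i_1}^{\epsilon_1}\cdots g_{i_{k-1}}^{\epsilon_{k-1}}[x,g_{i_k}^{\epsilon_k}x]$$ for any choice of the geodesic segments $[x,g_{i_j}^{\epsilon_j}x]$; in particular, for every $u\in U$, every geodesic segment $[x,ux]$ lies in the $a$-neighbourhood of $Ux$, where $a=\max_{1\le i\le n}(|g_i|_x/2+d_2)$; (3) for every freely reduced word $u=g_{i_1}^{\epsilon_1}\cdots g_{i_k}^{\epsilon_k}$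 and every $1\le j\le k$, $|u|_x\ge|g_{i_j}|_x-d_3$; (4) if $S$ is a subsegment of length greater than $d_4$ of a geodesic segment $[x,ux]$ with $u\in U$, then $S$ meets the $b$-neighbourhood of $Ux$, where $b=\max_{1\le i\le n}(|g_i|_x/2-c)$. Here the $r$-neighbourhood of a set $A$ is the set of points at distance at most $r$ from some point of $A$. -/

import Mathlib

namespace HypAction

/-- `S` is (the image of) a geodesic segment from `p` to `q`: the image of an isometric embedding of
the interval `[0, d(p, q)]` that maps the endpoints to `p` and `q`. The length of the segment is
`dist p q`. -/
def IsGeodesicSegment {X : Type*} [MetricSpace X] (S : Set X) (p q : X) : Prop :=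
  ∃ γ : ℝ → X, γ 0 = p ∧ γ (dist p q) = q ∧
    (∀ s ∈ Set.Icc 0 (dist p q), ∀ t ∈ Set.Icc 0 (dist p q), dist (γ s) (γ t) = |s - t|) ∧
    S = γ '' Set.Icc 0 (dist p q)

/-- A geodesic metric space: any two points are joined by a geodesic segment. -/
def IsGeodesicSpace (X : Type*) [MetricSpace X] : Prop :=
  ∀ p q : X, ∃ S : Set X, IsGeodesicSegment S p q

/-- The (closed) `r`-neighbourhood of a subset `A`. -/
def nbhd {X : Type*} [MetricSpace X] (r : ℝ) (A : Set X) : Set X :=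
  {p | ∃ a ∈ A, dist p a ≤ r}

/-- A `δ`-hyperbolic geodesic metric space: all geodesic triangles are `δ`-thin. -/
def IsHyperbolicSpace (X : Type*) [MetricSpace X] (δ : ℝ) : Prop :=
  IsGeodesicSpace X ∧
    ∀ (p q r : X) (A B C : Set X), IsGeodesicSegment A p q → IsGeodesicSegment B p r →
      IsGeodesicSegment C q r → A ⊆ nbhd δ (B ∪ C)

/-- The elementary Nielsen moves on `n`-tuples of elements of a group. -/
inductive NielsenMove {G : Type*} [Group G] {n : ℕ} : (Fin n → G) → (Fin n → G) → Prop
  | inv (M : Fin n → G) (i : Fin n) : NielsenMove M (Function.update M i (M i)⁻¹)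
  | mul (M : Fin n → G) (i j : Fin n) (hij : i ≠ j) :
      NielsenMove M (Function.update M i (M i * M j))
  | swap (M : Fin n → G) (i j : Fin n) (hij : i ≠ j) :
      NielsenMove M (fun k => M (Equiv.swap i j k))

/-- `M` and `M'` are Nielsen-equivalent: a finite chain of elementary Nielsen moves transforms
`M` into `M'`. -/
def NielsenEquiv {G : Type*} [Group G] {n : ℕ} (M M' : Fin n → G) : Prop :=
  Relation.ReflTransGen NielsenMove M M'

/-- The displacement `|g|_x = d(x, g x)`. -/
def displacement {X G : Type*} [MetricSpace X] [Group G] [MulAction G X] (x : X) (g : G) : ℝ :=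
  dist x (g • x)

/-- The translation length `‖g‖ = inf_y d(y, g y)` of `g` acting on `X`. -/
noncomputable def translationLength (X : Type*) {G : Type*} [MetricSpace X] [Group G]
    [MulAction G X] (g : G) : ℝ :=
  ⨅ y : X, dist y (g • y)

/-- `|M|_x = ∑ i, |g_i|_x` for a tuple `M = (g_1, …, g_n)`. -/
def tupleLength {X G : Type*} [MetricSpace X] [Group G] [MulAction G X] {n : ℕ}
    (x : X) (M : Fin n → G) : ℝ :=
  ∑ i, displacement x (M i)

/-- A tuple is minimal (with respect to the base point `x`) if `|M|_x ≤ |M'|_x + 1` for every tuple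
`M'` that is Nielsen-equivalent to `M`. -/
def IsMinimalTuple {X G : Type*} [MetricSpace X] [Group G] [MulAction G X] {n : ℕ}
    (x : X) (M : Fin n → G) : Prop :=
  ∀ M' : Fin n → G, NielsenEquiv M M' → tupleLength x M ≤ tupleLength x M' + 1

/-- The value `g_i` of the letter `(i, true)`, and `g_i⁻¹` of the letter `(i, false)`. -/
def letterVal {G : Type*} [Group G] {n : ℕ} (M : Fin n → G) (l : Fin n × Bool) : G :=
  if l.2 then M l.1 else (M l.1)⁻¹

/-- The product `g_{i_1}^{ε_1} ⋯ g_{i_k}^{ε_k}` of a word in the letters `g_i^{±1}`. -/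
def wordProd {G : Type*} [Group G] {n : ℕ} (M : Fin n → G) (w : List (Fin n × Bool)) : G :=
  (w.map (letterVal M)).prod

/-- The subgroup `U = ⟨M⟩` generated by the entries of `M`. -/
def tupleSubgroup {G : Type*} [Group G] {n : ℕ} (M : Fin n → G) : Subgroup G :=
  Subgroup.closure (Set.range M)

/-- `⟨M⟩` is freely generated by the tuple `M`: the canonical homomorphism from the free group on
`n` letters to `G` is injective. -/
def FreelyGenerates {G : Type*} [Group G] {n : ℕ} (M : Fin n → G) : Prop :=
  Function.Injective (FreeGroup.lift M)

/-- The word length of an element with respect to the generators `g_1, …, g_n`. -/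
noncomputable def wordLength {G : Type*} [Group G] {n : ℕ} (M : Fin n → G) (u : G) : ℕ :=
  sInf {k | ∃ w : List (Fin n × Bool), w.length = k ∧ wordProd M w = u}

/-- The word metric on `⟨M⟩` with respect to `g_1, …, g_n`. If `M` freely generates `⟨M⟩`, this is
the free group word metric. -/
noncomputable def wordDist {G : Type*} [Group G] {n : ℕ} (M : Fin n → G)
    (u v : tupleSubgroup M) : ℝ :=
  (wordLength M ((u : G)⁻¹ * (v : G)) : ℝ)

/-- `f` is a quasi-isometric embedding of `A`, with the distance function `dA`, into `X`. -/
def IsQuasiIsometricEmbedding {A X : Type*} [MetricSpace X] (dA : A → A → ℝ) (f : A → X) : Prop :=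
  ∃ K C : ℝ, 1 ≤ K ∧ 0 ≤ C ∧
    ∀ a b : A, dA a b / K - C ≤ dist (f a) (f b) ∧ dist (f a) (f b) ≤ K * dA a b + C

/-- The union `T_1 ∪ h_1 T_2 ∪ h_1 h_2 T_3 ∪ ⋯ ∪ h_1 ⋯ h_{k-1} T_k`, where `h_j` is the value of the
`j`-th letter of the word `w`. -/
def concatPath {X G : Type*} [MetricSpace X] [Group G] [MulAction G X] {n : ℕ}
    (M : Fin n → G) (w : List (Fin n × Bool)) (T : Fin w.length → Set X) : Set X :=
  ⋃ j : Fin w.length, (fun p : X => wordProd M (w.take j) • p) '' T j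

end HypAction

open HypAction

set_option linter.unusedSectionVars false

/-! Suppose no Nielsen-equivalent tuple starts with an element of small translation length.
Minimality then gives two facts about each `g_i`, with `V` the subgroup generated by the other
entries (`Dispersed`): up to an error 1, `g_i` is shortest in its double coset `V g_i V`, and every
element of that double coset moves every point far.

The letters are adjoined one at a time, by increasing displacement. Let `g_a`, of displacement `2h`,
be adjoined to a set `s` of letters no longer than it, and cut the path of a reduced word at the
midpoints of its `a`-letters. Two facts make the resulting broken geodesic well behaved.

Bounded backtracking at the midpoints (`Extension.excess_letterMid_le`): otherwise the geodesics
into the two adjacent blocks fellow-travel. By (4) for `s`, one of them soon comes substantially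
closer than `h` to its translate of the orbit, while by (2) for `s` the other never gets much
further than `h` from its own. Two orbit points are then so close that they yield an element of the
double coset of `g_a` that is too short.

Long blocks (`LongExtension.next_state`): consecutive midpoints differ by an element of that double
coset or, for opposite letters, by a nonempty reduced word over `s`; both move all points far.

By `FourPoint.excess_le_of_long` the errors of such a broken geodesic do not accumulate, so its
geometry is read off block by block. The induction (`exists_constants`) has to carry (2), (3), (4),
linear growth and the lower bound on the displacement of all points together, because each uses
others for the smaller set. -/

namespace HypAction

/-! ### Gromov products, the four-point inequality and broken geodesics -/

section Geometry

variable {X : Type*} [MetricSpace X]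

/-- The excess of the path `p → z → q` over the distance from `p` to `q`; this is twice the Gromov
product of `p` and `q` at `z`. -/
def excess (p q z : X) : ℝ := dist p z + dist z q - dist p q

/-- The four-point inequality with constant `4`. -/
def FourPoint (X : Type*) [MetricSpace X] : Prop :=
  ∀ a b c e : X, dist a c + dist b e ≤ max (dist a b + dist c e) (dist a e + dist b c) + 4

/-- Any two points are joined by points at every prescribed distance. -/
def HasBetween (X : Type*) [MetricSpace X] : Prop :=
  ∀ (p q : X) (t : ℝ), 0 ≤ t → t ≤ dist p q → ∃ z, dist p z = t ∧ dist z q = dist p q - t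

theorem excess_comm (p q z : X) : excess p q z = excess q p z := by
  unfold excess; rw [dist_comm p z, dist_comm z q, dist_comm p q]; ring

theorem excess_self (p z : X) : excess p p z = 2 * dist p z := by
  unfold excess; rw [dist_self, dist_comm z p]; ring

theorem excess_le_of_left {p q z : X} : excess p q z ≤ 2 * dist p z := by
  have := dist_triangle z p q
  unfold excess; rw [dist_comm z p] at this; linarith

theorem excess_le_add (p q z z' : X) : excess p q z ≤ excess p q z' + 2 * dist z z' := by
  have h1 := dist_triangle p z' z
  have h2 := dist_triangle z z' q
  rw [dist_comm z' z] at h1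
  unfold excess; linarith

theorem IsGeodesicSpace.hasBetween (h : IsGeodesicSpace X) : HasBetween X := by
  intro p q t h0 h1
  obtain ⟨S, γ, g0, g1, g, -⟩ := h p q
  refine ⟨γ t, ?_, ?_⟩
  · have := g 0 ⟨le_rfl, h0.trans h1⟩ t ⟨h0, h1⟩
    rw [g0] at this
    rw [this, zero_sub, abs_neg, abs_of_nonneg h0]
  · have := g t ⟨h0, h1⟩ (dist p q) ⟨h0.trans h1, le_rfl⟩
    rw [g1] at this
    rw [this, abs_sub_comm, abs_of_nonneg (by linarith)]

theorem IsGeodesicSegment.dist_add {S : Set X} {p q z : X} (h : IsGeodesicSegment S p q)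
    (hz : z ∈ S) : dist p z + dist z q = dist p q := by
  obtain ⟨γ, g0, g1, g, rfl⟩ := h
  obtain ⟨t, ⟨h0, h1⟩, rfl⟩ := hz
  have a := g 0 ⟨le_rfl, h0.trans h1⟩ t ⟨h0, h1⟩
  have b := g t ⟨h0, h1⟩ (dist p q) ⟨h0.trans h1, le_rfl⟩
  rw [g0, zero_sub, abs_neg, abs_of_nonneg h0] at a
  rw [g1, abs_sub_comm, abs_of_nonneg (by linarith)] at b
  linarith

theorem IsGeodesicSegment.symm {S : Set X} {p q : X} (h : IsGeodesicSegment S p q) :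
    IsGeodesicSegment S q p := by
  obtain ⟨γ, g0, g1, g, rfl⟩ := h
  refine ⟨fun t => γ (dist p q - t), by simpa using g1, by simp [dist_comm q p, g0], ?_, ?_⟩
  · rintro s ⟨s0, s1⟩ t ⟨t0, t1⟩
    rw [dist_comm q p] at s1 t1
    rw [g _ ⟨by linarith, by linarith⟩ _ ⟨by linarith, by linarith⟩, abs_sub_comm s t]
    congr 1; ring
  · ext z
    constructor
    · rintro ⟨t, ⟨t0, t1⟩, rfl⟩
      exact ⟨dist p q - t, ⟨by linarith, by rw [dist_comm q p]; linarith⟩, by simp⟩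
    · rintro ⟨t, ⟨t0, t1⟩, rfl⟩
      rw [dist_comm q p] at t1
      exact ⟨dist p q - t, ⟨by linarith, by linarith⟩, rfl⟩

theorem IsGeodesicSegment.isCompact {S : Set X} {p q : X} (h : IsGeodesicSegment S p q) :
    IsCompact S := by
  obtain ⟨γ, g0, g1, g, rfl⟩ := h
  refine isCompact_Icc.image_of_continuousOn ?_
  have : LipschitzOnWith 1 γ (Set.Icc 0 (dist p q)) := by
    refine LipschitzOnWith.of_dist_le_mul fun s hs t ht => ?_
    rw [g s hs t ht, Real.dist_eq]; simp
  exact this.continuousOn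

theorem IsGeodesicSegment.isPreconnected {S : Set X} {p q : X} (h : IsGeodesicSegment S p q) :
    IsPreconnected S := by
  obtain ⟨γ, g0, g1, g, rfl⟩ := h
  refine isPreconnected_Icc.image _ ?_
  have : LipschitzOnWith 1 γ (Set.Icc 0 (dist p q)) := by
    refine LipschitzOnWith.of_dist_le_mul fun s hs t ht => ?_
    rw [g s hs t ht, Real.dist_eq]; simp
  exact this.continuousOn

theorem IsGeodesicSegment.left_mem {S : Set X} {p q : X} (h : IsGeodesicSegment S p q) :
    p ∈ S := by
  obtain ⟨γ, g0, g1, g, rfl⟩ := h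
  exact ⟨0, ⟨le_rfl, dist_nonneg⟩, g0⟩

theorem IsGeodesicSegment.right_mem {S : Set X} {p q : X} (h : IsGeodesicSegment S p q) :
    q ∈ S := h.symm.left_mem

theorem nbhd_isClosed_of_isCompact {S : Set X} (h : IsCompact S) (r : ℝ) :
    IsClosed (nbhd r S) := by
  rcases le_or_gt 0 r with hr | hr
  · have : nbhd r S = Metric.cthickening r S := by
      rw [h.cthickening_eq_biUnion_closedBall hr]
      ext z; simp [nbhd]
    rw [this]; exact Metric.isClosed_cthickening
  · have : nbhd r S = ∅ := by
      ext z
      simp only [nbhd, Set.mem_ofPred_eq, Set.mem_empty_iff_false, iff_false, not_exists, not_and,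
        not_le]
      exact fun a _ => hr.trans_le dist_nonneg
    rw [this]; exact isClosed_empty

/-- In a hyperbolic space each side of a triangle has a point close to both other sides. -/
theorem IsHyperbolicSpace.exists_mem_nbhd (h : IsHyperbolicSpace X 1) {p q r : X} {A B C : Set X}
    (hA : IsGeodesicSegment A p q) (hB : IsGeodesicSegment B p r) (hC : IsGeodesicSegment C q r) :
    ∃ z ∈ A, (∃ b ∈ B, dist z b ≤ 1) ∧ ∃ c ∈ C, dist z c ≤ 1 := by
  have hsub : A ⊆ nbhd 1 B ∪ nbhd 1 C := by
    intro z hz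
    obtain ⟨a, ha | ha, had⟩ := h.2 p q r A B C hA hB hC hz
    · exact Or.inl ⟨a, ha, had⟩
    · exact Or.inr ⟨a, ha, had⟩
  have := isPreconnected_closed_iff.1 hA.isPreconnected _ _
    (nbhd_isClosed_of_isCompact hB.isCompact 1) (nbhd_isClosed_of_isCompact hC.isCompact 1) hsub
    ⟨p, hA.left_mem, p, hB.left_mem, by simp⟩ ⟨q, hA.right_mem, q, hC.left_mem, by simp⟩
  obtain ⟨z, hz, hb, hc⟩ := this
  exact ⟨z, hz, hb, hc⟩

/-- A point `z` of `[a, c]` that is 1-close to both `[a, b]` and `[c, b]` is also 1-close to `[a,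
e]` or `[c, e]`. Routing all distances through `z` loses 1 twice along `[a, c]` and 2 on the way
from `b` to `e`, hence the constant 4. -/
theorem IsHyperbolicSpace.fourPoint (h : IsHyperbolicSpace X 1) : FourPoint X := by
  intro a b c e
  obtain ⟨S, hS⟩ := h.1 a c
  obtain ⟨Sab, hab⟩ := h.1 a b
  obtain ⟨Scb, hcb⟩ := h.1 c b
  obtain ⟨Sae, hae⟩ := h.1 a e
  obtain ⟨Sce, hce⟩ := h.1 c e
  obtain ⟨z, hz, ⟨u, hu, hzu⟩, ⟨v, hv, hzv⟩⟩ := h.exists_mem_nbhd hS hab hcb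
  have h0 := hS.dist_add hz
  have hu' := hab.dist_add hu
  have hv' := hcb.dist_add hv
  have t1 := dist_triangle a u z
  have t2 := dist_triangle z v c
  have t1' := dist_triangle4 b u z e
  rw [dist_comm u z] at t1
  rw [dist_comm v c] at t2
  obtain ⟨y, hy | hy, hzy⟩ := h.2 a c e S Sae Sce hS hae hce hz
  · have hy' := hae.dist_add hy
    have t3 := dist_triangle a y z
    have t4 := dist_triangle4 b v z y
    have t5 := dist_triangle b y e
    rw [dist_comm y z] at t3
    rw [dist_comm b v, dist_comm v z] at t4
    have := le_max_right (dist a b + dist c e) (dist a e + dist b c)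
    rw [dist_comm b c] at this ⊢
    linarith
  · have hy' := hce.dist_add hy
    have t3 := dist_triangle z y c
    have t4 := dist_triangle4 b u z y
    have t5 := dist_triangle b y e
    rw [dist_comm y c] at t3
    rw [dist_comm b u, dist_comm u z] at t4
    have := le_max_left (dist a b + dist c e) (dist a e + dist b c)
    linarith

/-- Coarse thinness of triangles. -/
theorem FourPoint.thin (H : FourPoint X) {p q z : X} {ε : ℝ} (h : excess p q z ≤ ε) (r : X) :
    excess p r z ≤ ε + 4 ∨ excess r q z ≤ ε + 4 := by
  have := H p z q r
  unfold excess at *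
  rcases le_max_iff.1 (sub_le_iff_le_add.2 this) with h' | h'
  · right
    have e1 := dist_comm r z; have e2 := dist_comm q r
    have e3 := dist_comm z q
    linarith
  · left; linarith

theorem FourPoint.quad (H : FourPoint X) {p q z : X} {ε : ℝ} (h : excess p q z ≤ ε) (r s : X) :
    excess p r z ≤ ε + 4 ∨ excess r s z ≤ ε + 8 ∨ excess s q z ≤ ε + 8 := by
  rcases H.thin h r with h | h
  · exact Or.inl h
  · right
    rcases H.thin h s with h | h
    · left; linarith
    · right; linarith

/-- The position of `z'` is the Gromov product of `z` and `q` at `p`; it is the position at which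
the two sums in the four-point inequality for `p, z, q, z'` coincide. -/
theorem FourPoint.dist_proj_le (H : FourPoint X) {p q z z' : X}
    (h1 : dist p z' = (dist p z + dist p q - dist z q) / 2)
    (h2 : dist p z' + dist z' q = dist p q) : dist z z' ≤ excess p q z / 2 + 4 := by
  have := H p z q z'
  have e1 := dist_comm q z'
  unfold excess
  rcases le_max_iff.1 (sub_le_iff_le_add.2 this) with h' | h' <;> linarith

theorem proj_mem_Icc (p q z : X) :
    (dist p z + dist p q - dist z q) / 2 ∈ Set.Icc 0 (dist p q) := by
  have h1 := dist_triangle z p q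
  have h2 := dist_triangle p q z
  rw [dist_comm z p] at h1
  rw [dist_comm q z] at h2
  constructor <;> linarith

theorem FourPoint.exists_proj (H : FourPoint X) (B : HasBetween X) (p q z : X) :
    ∃ z', excess p q z' ≤ 0 ∧ dist z z' ≤ excess p q z / 2 + 4 := by
  obtain ⟨t0, t1⟩ := proj_mem_Icc p q z
  obtain ⟨z', h1, h2⟩ := B p q _ t0 t1
  exact ⟨z', by unfold excess; linarith, H.dist_proj_le h1 (by linarith)⟩

theorem IsGeodesicSegment.exists_mem_dist_eq {S : Set X} {p q : X} (h : IsGeodesicSegment S p q)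
    {t : ℝ} (ht : t ∈ Set.Icc 0 (dist p q)) : ∃ z ∈ S, dist p z = t := by
  obtain ⟨γ, g0, g1, g, rfl⟩ := h
  refine ⟨γ t, ⟨t, ht, rfl⟩, ?_⟩
  have := g 0 ⟨le_rfl, dist_nonneg⟩ t ht
  rw [g0] at this
  rw [this, zero_sub, abs_neg, abs_of_nonneg ht.1]

theorem FourPoint.exists_proj_mem (H : FourPoint X) {S : Set X} {p q : X}
    (h : IsGeodesicSegment S p q) (z : X) : ∃ z' ∈ S, dist z z' ≤ excess p q z / 2 + 4 := by
  obtain ⟨z', hz', hd⟩ := h.exists_mem_dist_eq (proj_mem_Icc p q z)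
  exact ⟨z', hz', H.dist_proj_le hd (h.dist_add hz')⟩

/-- Two points of a geodesic segment appear on it in one of the two possible orders. -/
theorem IsGeodesicSegment.dist_add_add {S : Set X} {p q y z : X} (h : IsGeodesicSegment S p q)
    (hy : y ∈ S) (hz : z ∈ S) : dist p y + dist y z + dist z q ≤ dist p q ∨
      dist p z + dist z y + dist y q ≤ dist p q := by
  have e1 := h.dist_add hy
  have e2 := h.dist_add hz
  obtain ⟨γ, g0, g1, g, rfl⟩ := h
  obtain ⟨s, hs, rfl⟩ := hy
  obtain ⟨t, ht, rfl⟩ := hz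
  have a := g 0 ⟨le_rfl, dist_nonneg⟩ s hs
  have b := g 0 ⟨le_rfl, dist_nonneg⟩ t ht
  rw [g0, zero_sub, abs_neg] at a b
  rw [abs_of_nonneg hs.1] at a
  rw [abs_of_nonneg ht.1] at b
  have c := g s hs t ht
  rcases le_total s t with hst | hst
  · left
    rw [abs_of_nonpos (by linarith)] at c
    linarith
  · right
    rw [abs_of_nonneg (by linarith)] at c
    rw [dist_comm (γ t) (γ s)]
    linarith

/-- Points at the same distance on two geodesics with the same origin. -/
theorem FourPoint.dist_le_of_fellow (H : FourPoint X) {y p q z z' : X} (hz : excess y p z ≤ 0)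
    (hz' : excess y q z' ≤ 0) (he : dist y z = dist y z')
    (ht : 2 * dist y z ≤ excess p q y) : dist z z' ≤ 8 := by
  have a := H y z p z'
  have b := H y z' q p
  unfold excess at *
  have c1 := dist_comm p y
  have c2 := dist_comm p q
  have c3 := dist_comm z' p
  rcases le_max_iff.1 (sub_le_iff_le_add.2 a) with h1 | h1 <;>
  rcases le_max_iff.1 (sub_le_iff_le_add.2 b) with h2 | h2 <;>
  linarith

/-- The property `Q` holds somewhere on each subinterval of length `ℓ` of a geodesic from `p` to
`q`. -/
def HoldsOften (p q : X) (ℓ : ℝ) (Q : X → Prop) : Prop :=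
  ∀ z₁ z₂, dist p z₁ + dist z₁ z₂ + dist z₂ q ≤ dist p q → ℓ ≤ dist z₁ z₂ →
    ∃ z, excess z₁ z₂ z ≤ 0 ∧ Q z

theorem HoldsOften.coarse (H : FourPoint X) (B : HasBetween X) {p q : X} {ℓ ε : ℝ} {Q : X → Prop}
    (h : HoldsOften p q ℓ Q) {x₁ x₂ : X} (h₁ : excess p q x₁ ≤ ε) (h₂ : excess p q x₂ ≤ ε)
    (hℓ : ℓ + ε + 12 ≤ dist x₁ x₂) :
    ∃ z w, excess x₁ x₂ z ≤ 0 ∧ Q w ∧ dist z w ≤ ε + 16 := by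
  obtain ⟨w₁, e1, d1⟩ := H.exists_proj B p q x₁
  have main : ∀ w₂ w, dist x₂ w₂ ≤ ε / 2 + 6 → excess w₁ w₂ w ≤ 0 → Q w →
      ∃ z w, excess x₁ x₂ z ≤ 0 ∧ Q w ∧ dist z w ≤ ε + 16 := by
    intro w₂ w d2 hw hQ
    obtain ⟨z, hz, hd⟩ := H.exists_proj B x₁ x₂ w
    refine ⟨z, w, hz, hQ, ?_⟩
    rw [dist_comm]
    have t1 := dist_triangle x₁ w₁ w
    have t2 := dist_triangle w w₂ x₂
    have t3 := dist_triangle4 w₁ x₁ x₂ w₂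
    have c1 := dist_comm x₁ w₁
    have c2 := dist_comm x₂ w₂
    unfold excess at *
    linarith
  have len : ∀ w₂, dist x₂ w₂ ≤ ε / 2 + 6 → ℓ ≤ dist w₁ w₂ := by
    intro w₂ d2
    have t3 := dist_triangle4 x₁ w₁ w₂ x₂
    have c2 := dist_comm x₂ w₂
    linarith
  -- Geodesics are not unique, so independent projections of `x₁` and `x₂` need not be aligned. The
  -- second point is therefore projected to a geodesic from `p` to `w₁` or from `w₁` to `q`, at the
  -- price of 2 in the distance.
  rcases H.thin h₂ w₁ with h' | h'
  · obtain ⟨w₂, e2, d2⟩ := H.exists_proj B p w₁ x₂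
    have d2' : dist x₂ w₂ ≤ ε / 2 + 6 := by linarith
    obtain ⟨w, hw, hQ⟩ := h w₂ w₁ (by unfold excess at *; linarith)
      (by rw [dist_comm]; exact len w₂ d2')
    exact main w₂ w d2' (by rwa [excess_comm]) hQ
  · obtain ⟨w₂, e2, d2⟩ := H.exists_proj B w₁ q x₂
    have d2' : dist x₂ w₂ ≤ ε / 2 + 6 := by linarith
    obtain ⟨w, hw, hQ⟩ := h w₁ w₂ (by unfold excess at *; linarith) (len w₂ d2')
    exact main w₂ w d2' hw hQ

/-- A broken geodesic with two long sides and a small backtrack. -/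
theorem FourPoint.excess_le_of_long (H : FourPoint X) {p y y' q : X} {κ κ' : ℝ}
    (h : excess p y' y ≤ κ) (h' : excess y q y' ≤ κ') (hL : κ + κ' + 4 < 2 * dist y y') :
    excess p q y ≤ κ + 4 ∧ excess p q y' ≤ κ' + 4 := by
  have := H p y y' q
  unfold excess at *
  have c := dist_comm y y'
  -- The alternative `dist p y + dist y' q` in the maximum would force `2 * dist y y' ≤ κ + κ' + 4`,
  -- so the four-point inequality bounds `dist p q` from below.
  rcases le_max_iff.1 (sub_le_iff_le_add.2 this) with h1 | h1 <;> constructor <;> linarith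

end Geometry

/-! ### Words and reduced words over a subset of the letters -/

section Words

variable {G : Type*} [Group G] {n : ℕ}

@[simp] theorem wordProd_nil (M : Fin n → G) : wordProd M [] = 1 := rfl

@[simp] theorem wordProd_cons (M : Fin n → G) (l : Fin n × Bool) (w : List (Fin n × Bool)) :
    wordProd M (l :: w) = letterVal M l * wordProd M w := by simp [wordProd]

@[simp] theorem wordProd_append (M : Fin n → G) (v w : List (Fin n × Bool)) :
    wordProd M (v ++ w) = wordProd M v * wordProd M w := by simp [wordProd]

theorem wordProd_flatten_replicate (M : Fin n → G) (w : List (Fin n × Bool)) (N : ℕ) :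
    wordProd M (List.replicate N w).flatten = wordProd M w ^ N := by
  induction N with
  | zero => simp
  | succ N ih => rw [List.replicate_succ, List.flatten_cons, wordProd_append, ih, pow_succ']

theorem letterVal_not (M : Fin n → G) (i : Fin n) (b : Bool) :
    letterVal M (i, !b) = (letterVal M (i, b))⁻¹ := by
  cases b <;> simp [letterVal]

theorem lift_mk_eq_wordProd (M : Fin n → G) (w : List (Fin n × Bool)) :
    FreeGroup.lift M (FreeGroup.mk w) = wordProd M w := by
  rw [FreeGroup.lift_mk, wordProd]
  congr 1
  refine List.map_congr_left fun l _ => ?_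
  obtain ⟨i, b⟩ := l
  cases b <;> simp [letterVal]

theorem wordProd_reduce (M : Fin n → G) (w : List (Fin n × Bool)) :
    wordProd M (FreeGroup.reduce w) = wordProd M w := by
  rw [← lift_mk_eq_wordProd, ← lift_mk_eq_wordProd, FreeGroup.reduce.self]

theorem isReduced_reduce (w : List (Fin n × Bool)) :
    FreeGroup.IsReduced (FreeGroup.reduce w) :=
  FreeGroup.isReduced_iff_reduce_eq.2 FreeGroup.reduce.idem

/-- The subgroup generated by the entries of `M` with index in `s`. -/
def subtupleSubgroup (M : Fin n → G) (s : Set (Fin n)) : Subgroup G :=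
  Subgroup.closure (M '' s)

/-- A freely reduced word all of whose letters have index in `s`. -/
structure ReducedOver (s : Set (Fin n)) (w : List (Fin n × Bool)) : Prop where
  isReduced : FreeGroup.IsReduced w
  mem : ∀ l ∈ w, l.1 ∈ s

theorem ReducedOver.nil (s : Set (Fin n)) : ReducedOver s [] := ⟨by simp, by simp⟩

theorem ReducedOver.of_infix {s : Set (Fin n)} {v w : List (Fin n × Bool)}
    (h : ReducedOver s w) (hv : v <:+: w) : ReducedOver s v :=
  ⟨h.isReduced.infix hv, fun l hl => h.mem l (hv.subset hl)⟩

theorem ReducedOver.right {s : Set (Fin n)} {v w : List (Fin n × Bool)}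
    (h : ReducedOver s (v ++ w)) : ReducedOver s w := h.of_infix ⟨v, [], by simp⟩

theorem letterVal_mem {M : Fin n → G} {s : Set (Fin n)} {l : Fin n × Bool} (h : l.1 ∈ s) :
    letterVal M l ∈ subtupleSubgroup M s := by
  have : M l.1 ∈ subtupleSubgroup M s := Subgroup.subset_closure ⟨_, h, rfl⟩
  unfold letterVal
  split
  · exact this
  · exact inv_mem this

theorem wordProd_mem {M : Fin n → G} {s : Set (Fin n)} {w : List (Fin n × Bool)}
    (h : ∀ l ∈ w, l.1 ∈ s) : wordProd M w ∈ subtupleSubgroup M s := by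
  refine Subgroup.list_prod_mem _ fun g hg => ?_
  obtain ⟨l, hl, rfl⟩ := List.mem_map.1 hg
  exact letterVal_mem (h l hl)

theorem exists_reducedOver {M : Fin n → G} {s : Set (Fin n)} {u : G}
    (hu : u ∈ subtupleSubgroup M s) : ∃ w, ReducedOver s w ∧ wordProd M w = u := by
  have : ∃ w : List (Fin n × Bool), (∀ l ∈ w, l.1 ∈ s) ∧ wordProd M w = u := by
    refine Subgroup.closure_induction_left (p := fun u _ =>
      ∃ w : List (Fin n × Bool), (∀ l ∈ w, l.1 ∈ s) ∧ wordProd M w = u) ⟨[], by simp⟩ ?_ ?_ hu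
    · rintro _ ⟨i, hi, rfl⟩ y - ⟨w, hw, rfl⟩
      refine ⟨(i, true) :: w, ?_, by simp [letterVal]⟩
      intro l hl
      rcases List.mem_cons.1 hl with rfl | hl
      exacts [hi, hw l hl]
    · rintro _ ⟨i, hi, rfl⟩ y - ⟨w, hw, rfl⟩
      refine ⟨(i, false) :: w, ?_, by simp [letterVal]⟩
      intro l hl
      rcases List.mem_cons.1 hl with rfl | hl
      exacts [hi, hw l hl]
  obtain ⟨w, hw, rfl⟩ := this
  exact ⟨FreeGroup.reduce w, ⟨isReduced_reduce w,
    fun l hl => hw l ((FreeGroup.Red.sublist FreeGroup.reduce.red).subset hl)⟩,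
    wordProd_reduce M w⟩

/-- A reduced word over `insert a s` is a reduced word over `s`, or is split at the first occurrence
of a letter with index `a`. -/
theorem ReducedOver.split {s : Set (Fin n)} {a : Fin n} {w : List (Fin n × Bool)}
    (h : ReducedOver (insert a s) w) :
    ReducedOver s w ∨ ∃ u f w', w = u ++ (a, f) :: w' ∧ ReducedOver s u := by
  induction w with
  | nil => exact Or.inl (.nil s)
  | cons l w ih =>
    by_cases hl : l.1 = a
    · obtain ⟨i, f⟩ := l
      obtain rfl : i = a := hl
      exact Or.inr ⟨[], f, w, rfl, .nil s⟩
    · have hls : l.1 ∈ s := (h.mem l (by simp)).resolve_left hl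
      rcases ih (h.right (v := [l])) with h' | ⟨u, f, w', rfl, hu⟩
      · left
        refine ⟨h.isReduced, fun l' hl' => ?_⟩
        rcases List.mem_cons.1 hl' with rfl | hl'
        exacts [hls, h'.mem _ hl']
      · right
        refine ⟨l :: u, f, w', rfl, h.isReduced.infix ⟨[], (a, f) :: w', by simp⟩, ?_⟩
        intro l' hl'
        rcases List.mem_cons.1 hl' with rfl | hl'
        exacts [hls, hu.mem _ hl']

end Words

/-! ### Nielsen moves and what minimality gives -/

section Nielsen

variable {G : Type*} [Group G] {n : ℕ}

theorem NielsenEquiv.trans {M M' M'' : Fin n → G} (h : NielsenEquiv M M')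
    (h' : NielsenEquiv M' M'') : NielsenEquiv M M'' := Relation.ReflTransGen.trans h h'

theorem nielsenEquiv_update_inv (M : Fin n → G) (i : Fin n) (g : G) :
    NielsenEquiv (Function.update M i g) (Function.update M i g⁻¹) := by
  have := NielsenMove.inv (Function.update M i g) i
  simp only [Function.update_self, Function.update_idem] at this
  exact .single this

theorem nielsenEquiv_update_mul (M : Fin n → G) {i j : Fin n} (hij : j ≠ i) (g : G) :
    NielsenEquiv (Function.update M i g) (Function.update M i (g * M j)) := by
  have := NielsenMove.mul (Function.update M i g) i j hij.symm
  simp only [Function.update_self, Function.update_idem, Function.update_of_ne hij] at this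
  exact .single this

theorem nielsenEquiv_update_mul_inv (M : Fin n → G) {i j : Fin n} (hij : j ≠ i) (g : G) :
    NielsenEquiv (Function.update M i g) (Function.update M i (g * (M j)⁻¹)) := by
  have h1 := NielsenMove.inv (Function.update M i g) j
  have h2 := nielsenEquiv_update_mul (Function.update M j (M j)⁻¹) hij g
  have h3 := NielsenMove.inv
    (Function.update (Function.update M j (M j)⁻¹) i (g * (M j)⁻¹)) j
  simp only [Function.update_of_ne hij, Function.update_self, inv_inv] at h1 h2 h3
  rw [Function.update_comm hij.symm] at h1
  have h4 : Function.update
      (Function.update (Function.update M j (M j)⁻¹) i (g * (M j)⁻¹)) j (M j) =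
      Function.update M i (g * (M j)⁻¹) := by
    rw [Function.update_comm hij, Function.update_idem,
      Function.update_eq_self_iff.2 (Function.update_of_ne hij _ _).symm]
  rw [h4] at h3
  exact ((Relation.ReflTransGen.single h1).trans h2).tail h3

theorem nielsenEquiv_update_mul_right (M : Fin n → G) (i : Fin n) (g : G) {v : G}
    (hv : v ∈ subtupleSubgroup M {i}ᶜ) :
    NielsenEquiv (Function.update M i g) (Function.update M i (g * v)) := by
  refine Subgroup.closure_induction_right (p := fun v _ =>
    NielsenEquiv (Function.update M i g) (Function.update M i (g * v))) ?_ ?_ ?_ hv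
  · rw [mul_one]; exact Relation.ReflTransGen.refl
  · rintro x - _ ⟨j, hj, rfl⟩ h
    rw [← mul_assoc]
    exact h.trans (nielsenEquiv_update_mul M hj _)
  · rintro x - _ ⟨j, hj, rfl⟩ h
    rw [← mul_assoc]
    exact h.trans (nielsenEquiv_update_mul_inv M hj _)

/-- Multiplying an entry of a tuple on both sides by elements of the subgroup generated by the other
entries gives a Nielsen-equivalent tuple. -/
theorem nielsenEquiv_update_mul_mul (M : Fin n → G) (i : Fin n) {u v : G}
    (hu : u ∈ subtupleSubgroup M {i}ᶜ) (hv : v ∈ subtupleSubgroup M {i}ᶜ) :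
    NielsenEquiv M (Function.update M i (u * M i * v)) := by
  -- The moves multiply on the right only; left multiplication by `u` is right multiplication of the
  -- inverse by `u⁻¹`.
  have h1 := nielsenEquiv_update_inv M i (M i)
  have h2 := nielsenEquiv_update_mul_right M i (M i)⁻¹ (inv_mem hu)
  have h3 := nielsenEquiv_update_inv M i ((M i)⁻¹ * u⁻¹)
  have h4 := nielsenEquiv_update_mul_right M i (u * M i) hv
  rw [Function.update_eq_self] at h1
  rw [mul_inv_rev, inv_inv, inv_inv] at h3
  exact ((h1.trans h2).trans h3).trans h4

variable {X : Type*} [MetricSpace X] [MulAction G X]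

theorem tupleLength_update (x : X) (M : Fin n → G) (i : Fin n) (g : G) :
    tupleLength x (Function.update M i g) =
      tupleLength x M - displacement x (M i) + displacement x g := by
  unfold tupleLength
  rw [← Finset.add_sum_erase _ _ (Finset.mem_univ i),
    ← Finset.add_sum_erase _ (fun j => displacement x (M j)) (Finset.mem_univ i)]
  have : ∑ j ∈ Finset.univ.erase i, displacement x (Function.update M i g j) =
      ∑ j ∈ Finset.univ.erase i, displacement x (M j) :=
    Finset.sum_congr rfl fun j hj => by rw [Function.update_of_ne (Finset.ne_of_mem_erase hj)]
  rw [this, Function.update_self]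
  ring

/-- Each entry of `M` is, up to an additive error `1`, shortest in its double coset of the subgroup
generated by the other entries, and the elements of this double coset move all points at least by
`d`. -/
structure Dispersed (x : X) (M : Fin n → G) (d : ℝ) : Prop where
  short : ∀ i, ∀ u ∈ subtupleSubgroup M {i}ᶜ, ∀ v ∈ subtupleSubgroup M {i}ᶜ,
    displacement x (M i) ≤ displacement x (u * M i * v) + 1
  moves : ∀ i, ∀ u ∈ subtupleSubgroup M {i}ᶜ, ∀ v ∈ subtupleSubgroup M {i}ᶜ,
    ∀ z : X, d ≤ dist z ((u * M i * v) • z)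

theorem Dispersed.mono {x : X} {M : Fin n → G} {d d' : ℝ} (h : Dispersed x M d) (hd : d' ≤ d) :
    Dispersed x M d' :=
  ⟨h.short, fun i u hu v hv z => hd.trans (h.moves i u hu v hv z)⟩

theorem translationLength_le (g : G) (z : X) : translationLength X g ≤ dist z (g • z) :=
  ciInf_le ⟨0, by rintro _ ⟨y, rfl⟩; exact dist_nonneg⟩ z

theorem IsMinimalTuple.dispersed {x : X} {M : Fin n → G} {d : ℝ} (hM : IsMinimalTuple x M)
    (hn : 0 < n)
    (hd : ∀ M' : Fin n → G, NielsenEquiv M M' → d < translationLength X (M' ⟨0, hn⟩)) :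
    Dispersed x M d := by
  constructor
  · intro i u hu v hv
    have := hM _ (nielsenEquiv_update_mul_mul M i hu hv)
    rw [tupleLength_update] at this
    linarith
  · intro i u hu v hv z
    refine le_trans ?_ (translationLength_le _ z)
    have h := nielsenEquiv_update_mul_mul M i hu hv
    by_cases hi : i = ⟨0, hn⟩
    · have := hd _ h
      rw [← hi, Function.update_self] at this
      exact this.le
    -- The assumption concerns first entries only, so the modified entry is swapped into first
    -- place.
    · have := hd _ (h.trans (.single (NielsenMove.swap _ i ⟨0, hn⟩ hi)))
      rw [Equiv.swap_apply_right, Function.update_self] at this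
      exact this.le

end Nielsen

/-! ### The properties carried through the induction on the letters -/

section Properties

variable {X G : Type*} [MetricSpace X] [Group G] [MulAction G X] {n : ℕ}

/-- Geodesics between the endpoints of reduced words over `s` stay close to the letters. -/
def TracksLetters (x : X) (M : Fin n → G) (s : Set (Fin n)) (A : ℝ) : Prop :=
  ∀ (k : G) (w : List (Fin n × Bool)) (z : X), ReducedOver s w → w ≠ [] →
    excess (k • x) ((k * wordProd M w) • x) z ≤ 0 →
    ∃ p l r, w = p ++ l :: r ∧
      excess ((k * wordProd M p) • x) ((k * wordProd M p * letterVal M l) • x) z ≤ A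

/-- Long subsegments of geodesics between the endpoints of reduced words over `s` come close to the
orbit. -/
def VisitsOrbit (x : X) (M : Fin n → G) (s : Set (Fin n)) (c ℓ : ℝ) : Prop :=
  ∀ (k : G) (w : List (Fin n × Bool)), ReducedOver s w →
    HoldsOften (k • x) ((k * wordProd M w) • x) ℓ fun z =>
      ∃ v ∈ subtupleSubgroup M s, ∃ i ∈ s, dist z ((k * v) • x) ≤ displacement x (M i) / 2 - c

/-- Nonempty reduced words over `s` move all points at least by `E`. -/
def MovesPoints (X : Type*) [MetricSpace X] [MulAction G X] (M : Fin n → G) (s : Set (Fin n))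
    (E : ℝ) : Prop :=
  ∀ w : List (Fin n × Bool), ReducedOver s w → w ≠ [] → ∀ z : X, E ≤ dist z (wordProd M w • z)

/-- Reduced words over `s` are at least as long as each of their letters, up to an error `B`. -/
def DominatesLetters (x : X) (M : Fin n → G) (s : Set (Fin n)) (B : ℝ) : Prop :=
  ∀ w : List (Fin n × Bool), ReducedOver s w → ∀ l ∈ w,
    displacement x (M l.1) - B ≤ displacement x (wordProd M w)

/-- The displacement of reduced words over `s` grows linearly with their length. -/
def LinearGrowth (x : X) (M : Fin n → G) (s : Set (Fin n)) : Prop :=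
  ∃ ε > 0, ∃ C ≥ 0, ∀ w : List (Fin n × Bool), ReducedOver s w →
    ε * w.length - C ≤ displacement x (wordProd M w)

/-- The point `y` is at distance at most `r` from the translate by `k` of the orbit of `x` under the
subgroup generated by the entries of `M` with index in `s`. -/
def Anchored (x : X) (M : Fin n → G) (s : Set (Fin n)) (r : ℝ) (k : G) (y : X) : Prop :=
  ∃ v ∈ subtupleSubgroup M s, dist y ((k * v) • x) ≤ r

theorem Anchored.mono {x : X} {M : Fin n → G} {s s' : Set (Fin n)} {r r' : ℝ} {k : G} {y : X}
    (h : Anchored x M s r k y) (hs : s ⊆ s') (hr : r ≤ r') : Anchored x M s' r' k y := by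
  obtain ⟨v, hv, hd⟩ := h
  exact ⟨v, Subgroup.closure_mono (Set.image_mono hs) hv, hd.trans hr⟩

theorem Anchored.of_mul {x : X} {M : Fin n → G} {s : Set (Fin n)} {r : ℝ} {k u : G} {y : X}
    (h : Anchored x M s r (k * u) y) (hu : u ∈ subtupleSubgroup M s) : Anchored x M s r k y := by
  obtain ⟨v, hv, hd⟩ := h
  exact ⟨u * v, mul_mem hu hv, by rwa [← mul_assoc]⟩

theorem displacement_nonneg (x : X) (g : G) : 0 ≤ displacement x g := dist_nonneg

variable [IsIsometricSMul G X]

theorem dist_mul_smul_mul_smul (k u v : G) (y z : X) :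
    dist ((k * u) • y) ((k * v) • z) = dist (u • y) (v • z) := by
  rw [mul_smul, mul_smul, dist_smul]

theorem displacement_inv (x : X) (g : G) : displacement x g⁻¹ = displacement x g := by
  unfold displacement
  rw [← dist_smul g x, smul_inv_smul, dist_comm]

theorem displacement_letterVal (x : X) (M : Fin n → G) (l : Fin n × Bool) :
    displacement x (letterVal M l) = displacement x (M l.1) := by
  unfold letterVal
  split
  · rfl
  · exact displacement_inv x _

theorem dist_smul_mul_smul (x : X) (k g : G) : dist (k • x) ((k * g) • x) = displacement x g := by
  rw [mul_smul, dist_smul]; rfl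

end Properties

/-! ### Backtracking at the midpoint of the longest letter -/

section Blocks

variable {X G : Type*} [MetricSpace X] [Group G] [MulAction G X] [IsIsometricSMul G X] {n : ℕ}
  {x : X} {M : Fin n → G} {s : Set (Fin n)} {a : Fin n} {m : X} {h A ℓ₀ : ℝ}

theorem TracksLetters.coarse (T : TracksLetters x M s A) (H : FourPoint X) (B : HasBetween X)
    {k : G} {u : List (Fin n × Bool)} (hu : ReducedOver s u) {z : X} {δ : ℝ}
    (hz : excess (k • x) ((k * wordProd M u) • x) z ≤ δ) :
    (u = [] ∧ 2 * dist z (k • x) ≤ δ) ∨ ∃ p l r, u = p ++ l :: r ∧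
      excess ((k * wordProd M p) • x) ((k * wordProd M p * letterVal M l) • x) z ≤ A + δ + 8 := by
  rcases eq_or_ne u [] with rfl | hne
  · left
    refine ⟨rfl, ?_⟩
    rwa [wordProd_nil, mul_one, excess_self, dist_comm] at hz
  · right
    obtain ⟨z', h1, h2⟩ := H.exists_proj B (k • x) ((k * wordProd M u) • x) z
    obtain ⟨p, l, r, rfl, hp⟩ := T k u z' hu hne h1
    refine ⟨p, l, r, rfl, (excess_le_add _ _ z z').trans ?_⟩
    linarith

/-- The situation where a letter with index `a` is added to the letters with index in `s`. The point
`m` is a midpoint of `x` and `g_a x`. -/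
structure Extension (x : X) (M : Fin n → G) (s : Set (Fin n)) (a : Fin n) (m : X) (h A ℓ₀ : ℝ) :
    Prop where
  four : FourPoint X
  between : HasBetween X
  A_nonneg : 0 ≤ A
  ℓ_nonneg : 0 ≤ ℓ₀
  dist_left : dist x m = h
  dist_right : dist m (M a • x) = h
  notMem : a ∉ s
  displacement_eq : displacement x (M a) = 2 * h
  displacement_le : ∀ i ∈ s, displacement x (M i) ≤ 2 * h
  tracks : TracksLetters x M s A
  visits : VisitsOrbit x M s (A / 2 + 42) ℓ₀
  sep : ∀ u ∈ subtupleSubgroup M s, ∀ v ∈ subtupleSubgroup M s, ∀ f,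
    2 * h - 1 ≤ dist (u • x) ((letterVal M (a, f) * v) • x)

/-- The midpoint of the letter `(a, f)`. -/
def letterMid (M : Fin n → G) (a : Fin n) (m : X) (f : Bool) : X :=
  if f then m else (M a)⁻¹ • m

namespace Extension

theorem h_nonneg (S : Extension x M s a m h A ℓ₀) : 0 ≤ h := S.dist_left ▸ dist_nonneg

theorem dist_letterMid (S : Extension x M s a m h A ℓ₀) (f : Bool) :
    dist (letterMid M a m f) x = h := by
  cases f
  · rw [letterMid, if_neg (by simp), ← dist_smul (M a), smul_inv_smul, S.dist_right]
  · rw [letterMid, if_pos rfl, dist_comm, S.dist_left]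

theorem dist_letterMid_right (S : Extension x M s a m h A ℓ₀) (f : Bool) :
    dist (letterMid M a m f) (letterVal M (a, f) • x) = h := by
  cases f
  · simp only [letterMid, letterVal, Bool.false_eq_true, if_false]
    rw [dist_smul, dist_comm, S.dist_left]
  · simp only [letterMid, letterVal, if_true]
    exact S.dist_right

theorem smul_letterMid_not (f : Bool) :
    letterVal M (a, f) • letterMid M a m (!f) = letterMid M a m f := by
  cases f <;> simp [letterMid, letterVal]

theorem dist_frame (S : Extension x M s a m h A ℓ₀) (k : G) (f : Bool) :
    dist (k • letterMid M a m f) (k • x) = h := by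
  rw [dist_smul, S.dist_letterMid]

theorem dist_frame_right (S : Extension x M s a m h A ℓ₀) (k : G) (f : Bool) :
    dist (k • letterMid M a m f) ((k * letterVal M (a, f)) • x) = h := by
  rw [mul_smul, dist_smul, S.dist_letterMid_right]

/-- Away from the two legs joining `y` and `y'` to the orbit, `z` has excess at most `A + 16` over a
single letter. That letter has length at most `2 * h`, so the nearer endpoint is within `h + A / 2 +
8`. -/
theorem exists_dist_le (S : Extension x M s a m h A ℓ₀) {k : G} {y y' z : X}
    (hy : Anchored x M s h k y) (hy' : Anchored x M s h k y') (hz : excess y y' z ≤ 0) :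
    Anchored x M s (h + (A / 2 + 8)) k z := by
  obtain ⟨v, hv, hyv⟩ := hy
  obtain ⟨v', hv', hyv'⟩ := hy'
  have hA := S.A_nonneg
  have hh := S.h_nonneg
  rcases S.four.quad hz ((k * v) • x) ((k * v') • x) with h1 | h1 | h1
  · refine ⟨v, hv, ?_⟩
    have := dist_triangle y z ((k * v) • x)
    have := dist_nonneg (x := y) (y := z)
    unfold excess at h1
    linarith
  · obtain ⟨w, hw, hwv⟩ := exists_reducedOver (mul_mem (inv_mem hv) hv')
    rw [show k * v' = k * v * wordProd M w by rw [hwv]; group] at h1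
    rcases S.tracks.coarse S.four S.between hw h1 with ⟨-, h2⟩ | ⟨p, l, r, rfl, h2⟩
    · exact ⟨v, hv, by linarith⟩
    · have hp : wordProd M p ∈ subtupleSubgroup M s :=
        wordProd_mem fun l hl => hw.mem l (by simp [hl])
      have hls : l.1 ∈ s := hw.mem l (by simp)
      have hd := dist_smul_mul_smul x (k * v * wordProd M p) (letterVal M l)
      rw [displacement_letterVal] at hd
      have := S.displacement_le _ hls
      unfold excess at h2
      rw [dist_comm _ z] at h2
      by_cases h3 : dist z ((k * v * wordProd M p) • x) ≤ h + (A / 2 + 8)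
      · exact ⟨v * wordProd M p, mul_mem hv hp, by rwa [← mul_assoc]⟩
      · refine ⟨v * wordProd M p * letterVal M l, mul_mem (mul_mem hv hp) (letterVal_mem hls), ?_⟩
        rw [← mul_assoc, ← mul_assoc]
        linarith
  · refine ⟨v', hv', ?_⟩
    have := dist_triangle z y' ((k * v') • x)
    have := dist_nonneg (x := z) (y := y')
    have c := dist_comm y' ((k * v') • x)
    have c' := dist_comm ((k * v') • x) z
    unfold excess at h1
    linarith

/-- Trimming `c + 8` at both ends leaves points `x₁`, `x₂` far from `y` and `y'`. If one of them is
close to a leg joining `y` or `y'` to the orbit, it is already `h - c` close to the orbit. Otherwise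
both lie along a geodesic between orbit points, and `VisitsOrbit` applies; passing to nearby
geodesics costs the extra 24. -/
theorem holdsOften (S : Extension x M s a m h A ℓ₀) {k : G} {y y' : X} {c ℓ : ℝ} (hc : 0 ≤ c)
    (hℓ : 0 ≤ ℓ) (V : VisitsOrbit x M s (c + 24) ℓ)
    (hy : Anchored x M s h k y) (hy' : Anchored x M s h k y') :
    HoldsOften y y' (2 * (c + 8) + ℓ + 20) (Anchored x M s (h - c) k) := by
  intro z₁ z₂ hz hlen
  obtain ⟨v, hv, hyv⟩ := hy
  obtain ⟨v', hv', hyv'⟩ := hy'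
  obtain ⟨x₁, a₁, b₁⟩ := S.between z₁ z₂ (c + 8) (by linarith) (by linarith)
  obtain ⟨x₂, a₂, b₂⟩ := S.between x₁ z₂ (dist z₁ z₂ - 2 * (c + 8)) (by linarith) (by linarith)
  have t1 := dist_triangle y z₁ x₁
  have t2 := dist_triangle x₁ z₂ y'
  have t3 := dist_triangle4 y z₁ x₁ x₂
  have t4 := dist_triangle x₂ z₂ y'
  have t5 := dist_triangle z₁ x₁ x₂
  have t6 := dist_triangle4 y x₁ x₂ y'
  have t7 := dist_triangle y x₁ y'
  have t8 := dist_triangle y x₂ y'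
  have t9 := dist_triangle z₁ x₂ z₂
  have n1 := dist_nonneg (x := y) (y := z₁)
  have n2 := dist_nonneg (x := z₂) (y := y')
  have side : ∀ p, excess y y' p ≤ 0 → excess z₁ z₂ p ≤ 0 → c + 8 ≤ dist y p →
      c + 8 ≤ dist p y' → (∃ z, excess z₁ z₂ z ≤ 0 ∧ Anchored x M s (h - c) k z) ∨
      excess ((k * v) • x) ((k * v') • x) p ≤ 8 := by
    intro p hp hp' l1 l2
    rcases S.four.quad hp ((k * v) • x) ((k * v') • x) with h1 | h1 | h1
    · left
      refine ⟨p, hp', v, hv, ?_⟩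
      unfold excess at h1
      linarith
    · right; linarith
    · left
      refine ⟨p, hp', v', hv', ?_⟩
      unfold excess at h1
      have c1 := dist_comm p ((k * v') • x)
      have c2 := dist_comm y' ((k * v') • x)
      have c3 := dist_comm y' p
      linarith
  have e1 : excess z₁ z₂ x₁ ≤ 0 := by unfold excess; linarith
  have e2 : excess z₁ z₂ x₂ ≤ 0 := by unfold excess; linarith
  rcases side x₁ (by unfold excess; linarith) e1 (by linarith) (by linarith) with h1 | h1
  · exact h1
  rcases side x₂ (by unfold excess; linarith) e2 (by linarith) (by linarith) with h2 | h2
  · exact h2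
  obtain ⟨w, hw, hwv⟩ := exists_reducedOver (mul_mem (inv_mem hv) hv')
  rw [show k * v' = k * v * wordProd M w by rw [hwv]; group] at h1 h2
  obtain ⟨z, q, hz', ⟨u, hu, i, hi, hd⟩, hzq⟩ :=
    (V (k * v) w hw).coarse S.four S.between h1 h2 (by linarith)
  refine ⟨z, ?_, v * u, mul_mem hv hu, ?_⟩
  · have u1 := dist_triangle z₁ x₁ z
    have u2 := dist_triangle z x₂ z₂
    unfold excess at *
    linarith
  · have := S.displacement_le i hi
    have := dist_triangle z q ((k * v * u) • x)
    rw [← mul_assoc]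
    linarith

/-- The Gromov product at the midpoint of a letter with index `a` is bounded. -/
theorem excess_letterMid_le (S : Extension x M s a m h A ℓ₀) {k : G} {f : Bool} {y q : X}
    (hy : Anchored x M s h k y) (hq : Anchored x M s h (k * letterVal M (a, f)) q) :
    excess y q (k • letterMid M a m f) ≤ 2 * (A + 72 + ℓ₀) := by
  by_contra! hlt
  set o := k • letterMid M a m f with ho
  have hA := S.A_nonneg
  have hℓ := S.ℓ_nonneg
  have b1 : excess y q o ≤ 2 * dist o q := by
    rw [excess_comm, dist_comm o]; exact excess_le_of_left
  have b2 : excess y q o ≤ 2 * dist o y := by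
    rw [dist_comm o]; exact excess_le_of_left
  have ho1 : Anchored x M s h k o := ⟨1, one_mem _, by rw [mul_one]; exact (S.dist_frame k f).le⟩
  have ho2 : Anchored x M s h (k * letterVal M (a, f)) o :=
    ⟨1, one_mem _, by rw [mul_one]; exact (S.dist_frame_right k f).le⟩
  -- The length `A + 72 + ℓ₀` is the one required by `holdsOften` for `c = A / 2 + 18`. It is at
  -- most half the excess, so both geodesics from `o` fellow-travel this far.
  obtain ⟨z₂, d1, d2⟩ := S.between o q (A + 72 + ℓ₀) (by linarith) (by linarith)
  have V : VisitsOrbit x M s (A / 2 + 18 + 24) ℓ₀ := by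
    rw [show A / 2 + 18 + 24 = A / 2 + 42 by ring]; exact S.visits
  obtain ⟨z, e1, v, hv, hzv⟩ := S.holdsOften (by linarith) hℓ V ho2 hq o z₂
    (by rw [dist_self]; linarith) (by linarith)
  have hz1 : dist o z ≤ A + 72 + ℓ₀ := by
    have := dist_nonneg (x := z) (y := z₂)
    unfold excess at e1; linarith
  obtain ⟨z', d3, d4⟩ := S.between o y (dist o z) dist_nonneg (by linarith)
  have e2 : excess o q z ≤ 0 := by
    have := dist_triangle z z₂ q
    unfold excess at *; linarith
  have e3 : excess o y z' ≤ 0 := by unfold excess; linarith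
  obtain ⟨v', hv', hzv'⟩ := S.exists_dist_le ho1 hy e3
  have e4 := S.four.dist_le_of_fellow e2 e3 d3.symm (by rw [excess_comm]; linarith)
  -- Via `z'` and `z`, the two orbit points are at distance at most `(h + A / 2 + 8) + 8 + (h - A /
  -- 2 - 18) = 2 * h - 2`, less than the `2 * h - 1` that `sep` demands.
  have := S.sep v' hv' v hv f
  rw [← dist_mul_smul_mul_smul k, ← mul_assoc] at this
  have := dist_triangle4 ((k * v') • x) z' z ((k * letterVal M (a, f) * v) • x)
  rw [dist_comm _ z', dist_comm z' z] at this
  linarith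

theorem le_dist_letterMid (S : Extension x M s a m h A ℓ₀) {k u v : G} (f : Bool)
    (hu : u ∈ subtupleSubgroup M s) (hv : v ∈ subtupleSubgroup M s) :
    h - 1 ≤ dist ((k * v) • x) ((k * u) • letterMid M a m f) := by
  have h1 := S.sep (u⁻¹ * v) (mul_mem (inv_mem hu) hv) 1 (one_mem _) f
  have h2 := S.dist_letterMid_right f
  have h3 := dist_triangle ((u⁻¹ * v) • x) (letterMid M a m f) (letterVal M (a, f) • x)
  rw [dist_mul_smul_mul_smul, ← dist_smul u⁻¹, ← mul_smul, ← mul_smul, inv_mul_cancel, one_smul]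
  rw [mul_one] at h1
  linarith

theorem le_dist_letterMid_right (S : Extension x M s a m h A ℓ₀) {k v : G} (f : Bool)
    (hv : v ∈ subtupleSubgroup M s) :
    h - 1 ≤ dist (k • letterMid M a m f) ((k * letterVal M (a, f) * v) • x) := by
  have h1 := S.sep 1 (one_mem _) v hv f
  have h2 := S.dist_letterMid f
  have h3 := dist_triangle x (letterMid M a m f) ((letterVal M (a, f) * v) • x)
  have c1 := dist_comm x (letterMid M a m f)
  rw [one_smul] at h1
  rw [mul_assoc, mul_smul, dist_smul]
  linarith

end Extension

end Blocks

/-! ### Traversing a word from midpoint to midpoint -/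

section States

variable {X G : Type*} [MetricSpace X] [Group G] [MulAction G X] [IsIsometricSMul G X] {n : ℕ}
  {x : X} {M : Fin n → G} {s : Set (Fin n)} {a : Fin n} {m : X} {h A ℓ₀ τ L : ℝ}

/-- An extension all of whose blocks are long compared to the bound `τ` for the backtracking. -/
structure LongExtension (x : X) (M : Fin n → G) (s : Set (Fin n)) (a : Fin n) (m : X)
    (h A ℓ₀ τ L : ℝ) : Prop extends Extension x M s a m h A ℓ₀ where
  τ_eq : τ = 2 * (A + 72 + ℓ₀)
  moves : MovesPoints X M s L
  moves_letter : ∀ f, ∀ u ∈ subtupleSubgroup M s, ∀ z : X, L ≤ dist z ((letterVal M (a, f) * u) • z)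
  L_le : L ≤ h - 1
  le_L : τ + 8 ≤ L

/-- A stage in the traversal of the path given by a word: `w` is the word that remains, to be read
from the frame `k`, and `y` is the last midpoint of a letter with index `a`. -/
structure State (x : X) (M : Fin n → G) (s : Set (Fin n)) (a : Fin n) (m : X) (h L : ℝ)
    (k : G) (y : X) (w : List (Fin n × Bool)) : Prop where
  near : dist y (k • x) ≤ h
  reduced : ReducedOver (insert a s) w
  step : ∀ u f w', w = u ++ (a, f) :: w' → ReducedOver s u →
    L ≤ dist y ((k * wordProd M u) • letterMid M a m f)

theorem ReducedOver.wordProd_mem {w : List (Fin n × Bool)} (hw : ReducedOver s w) :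
    wordProd M w ∈ subtupleSubgroup M s := HypAction.wordProd_mem hw.mem

theorem mul_wordProd_split (k : G) (u w : List (Fin n × Bool)) (l : Fin n × Bool) :
    k * wordProd M (u ++ l :: w) = k * wordProd M u * letterVal M l * wordProd M w := by
  simp [mul_assoc]

theorem State.anchored {k : G} {y : X} {w : List (Fin n × Bool)}
    (Z : State x M s a m h L k y w) : Anchored x M s h k y :=
  ⟨1, one_mem _, by rw [mul_one]; exact Z.near⟩

namespace LongExtension

theorem anchored_end (S : LongExtension x M s a m h A ℓ₀ τ L) (k : G)
    {w : List (Fin n × Bool)} (hw : ReducedOver s w) :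
    Anchored x M s h k ((k * wordProd M w) • x) :=
  ⟨_, hw.wordProd_mem, by rw [dist_self]; exact S.h_nonneg⟩

theorem anchored_mid (S : LongExtension x M s a m h A ℓ₀ τ L) (k : G) (f : Bool)
    {u : List (Fin n × Bool)} (hu : ReducedOver s u) :
    Anchored x M s h k ((k * wordProd M u) • letterMid M a m f) :=
  ⟨_, hu.wordProd_mem, (S.dist_frame _ f).le⟩

theorem excess_le (S : LongExtension x M s a m h A ℓ₀ τ L) {k : G} {f : Bool} {y q : X}
    {u : List (Fin n × Bool)} (hu : ReducedOver s u) (hy : Anchored x M s h k y)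
    (hq : Anchored x M s h (k * wordProd M u * letterVal M (a, f)) q) :
    excess y q ((k * wordProd M u) • letterMid M a m f) ≤ τ := by
  rw [S.τ_eq]
  refine S.excess_letterMid_le (Anchored.of_mul (u := (wordProd M u)⁻¹) ?_
    (inv_mem hu.wordProd_mem)) hq
  rwa [mul_inv_cancel_right]

theorem τ_nonneg (S : LongExtension x M s a m h A ℓ₀ τ L) : 0 ≤ τ := by
  have := S.A_nonneg; have := S.ℓ_nonneg
  rw [S.τ_eq]; linarith

theorem initial_state (S : LongExtension x M s a m h A ℓ₀ τ L) (k : G)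
    {w : List (Fin n × Bool)} (hw : ReducedOver (insert a s) w) :
    State x M s a m h L k (k • x) w := by
  refine ⟨by rw [dist_self]; exact S.h_nonneg, hw, fun u f w' _ hu => S.L_le.trans ?_⟩
  have := S.le_dist_letterMid (k := k) f hu.wordProd_mem (one_mem (subtupleSubgroup M s))
  rwa [mul_one] at this

/-- If the next `a`-letter has the same sign, the next midpoint is the translate of the current one
under an element of the double coset of `g_a`. If it has the opposite sign, both are translates of
one midpoint, differing by the word `v` between the two letters; `v` is nonempty because the whole
word is reduced. -/
theorem next_state (S : LongExtension x M s a m h A ℓ₀ τ L) {k : G}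
    {u w : List (Fin n × Bool)} {f : Bool}
    (hw : ReducedOver (insert a s) (u ++ (a, f) :: w)) :
    State x M s a m h L (k * wordProd M u * letterVal M (a, f))
      ((k * wordProd M u) • letterMid M a m f) w := by
  refine ⟨(S.dist_frame_right _ f).le, hw.of_infix ⟨u ++ [(a, f)], [], by simp⟩, ?_⟩
  rintro v f' w' rfl hv
  rw [mul_assoc (k * wordProd M u), mul_smul (k * wordProd M u), dist_smul]
  by_cases hf : f' = f
  · subst hf
    exact S.moves_letter f' _ hv.wordProd_mem _
  · obtain rfl : f' = !f := by cases f <;> cases f' <;> simp_all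
    rw [← Extension.smul_letterMid_not f, mul_smul, dist_smul]
    refine S.moves v hv ?_ _
    rintro rfl
    have := (hw.of_infix (v := [(a, f), (a, !f)]) ⟨u, w', by simp⟩).isReduced
    simp at this

/-- Induction along the letters with index `a` of a word. -/
theorem state_induction (S : LongExtension x M s a m h A ℓ₀ τ L)
    {motive : G → X → List (Fin n × Bool) → Prop}
    (base : ∀ k y w, State x M s a m h L k y w → ReducedOver s w → motive k y w)
    (step : ∀ k y u f w, State x M s a m h L k y (u ++ (a, f) :: w) → ReducedOver s u →
      State x M s a m h L (k * wordProd M u * letterVal M (a, f))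
        ((k * wordProd M u) • letterMid M a m f) w →
      motive (k * wordProd M u * letterVal M (a, f))
        ((k * wordProd M u) • letterMid M a m f) w → motive k y (u ++ (a, f) :: w))
    {k : G} {y : X} {w : List (Fin n × Bool)} (Z : State x M s a m h L k y w) :
    motive k y w := by
  induction hN : w.length using Nat.strong_induction_on generalizing k y w with
  | _ N ih =>
    rcases Z.reduced.split with hw | ⟨u, f, w', rfl, hu⟩
    · exact base k y w Z hw
    · have Z' := S.next_state (k := k) Z.reduced
      exact step k y u f w' Z hu Z' (ih w'.length (by simp at hN; omega) Z' rfl)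

/-- If the backtracking at `y` is bounded for all possible next points, then so is that towards the
endpoint of the path. -/
theorem excess_end_le (S : LongExtension x M s a m h A ℓ₀ τ L) {k : G} {y : X}
    {w : List (Fin n × Bool)} (Z : State x M s a m h L k y w) {p : X} {κ : ℝ} (hκ : κ ≤ τ + 4)
    (hp : ∀ q, Anchored x M s h k q → excess p q y ≤ κ) :
    excess p ((k * wordProd M w) • x) y ≤ κ + 4 := by
  revert p κ
  refine S.state_induction (motive := fun k y w => ∀ {p : X} {κ : ℝ}, κ ≤ τ + 4 →
    (∀ q, Anchored x M s h k q → excess p q y ≤ κ) →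
    excess p ((k * wordProd M w) • x) y ≤ κ + 4) ?_ ?_ Z
  · intro k y w Z hw p κ hκ hp
    linarith [hp _ (S.anchored_end k hw)]
  · intro k y u f w Z hu Z' ih p κ hκ hp
    rw [mul_wordProd_split]
    have hlong := Z.step u f w rfl hu
    -- The induction restarts with `y` as base point and the uniform bound `τ`, so the loss of 4 is
    -- incurred once and not once per block.
    have h1 := ih (p := y) (κ := τ) (by linarith) fun q hq => S.excess_le hu Z.anchored hq
    have := S.le_L
    exact (S.four.excess_le_of_long (hp _ (S.anchored_mid k f hu)) h1 (by linarith)).1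

theorem le_dist_end (S : LongExtension x M s a m h A ℓ₀ τ L) {k : G} {y : X}
    {u w : List (Fin n × Bool)} {f : Bool} (Z : State x M s a m h L k y (u ++ (a, f) :: w))
    (hu : ReducedOver s u) :
    dist y ((k * wordProd M u) • letterMid M a m f) +
      dist ((k * wordProd M u) • letterMid M a m f)
        ((k * wordProd M (u ++ (a, f) :: w)) • x) - (τ + 4) ≤
      dist y ((k * wordProd M (u ++ (a, f) :: w)) • x) := by
  have h1 := S.excess_end_le (S.next_state (k := k) Z.reduced) (p := y) (κ := τ)
    (by linarith) fun q hq => S.excess_le hu Z.anchored hq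
  rw [← mul_wordProd_split] at h1
  unfold excess at h1
  linarith

theorem half_le_dist_end (S : LongExtension x M s a m h A ℓ₀ τ L) {k : G} {y : X}
    {w : List (Fin n × Bool)} (Z : State x M s a m h L k y w)
    (hy : ∀ v ∈ subtupleSubgroup M s, h - 1 ≤ dist y ((k * v) • x)) :
    h - 1 ≤ dist y ((k * wordProd M w) • x) := by
  revert hy
  refine S.state_induction (motive := fun k y w =>
    (∀ v ∈ subtupleSubgroup M s, h - 1 ≤ dist y ((k * v) • x)) →
    h - 1 ≤ dist y ((k * wordProd M w) • x)) ?_ ?_ Z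
  · intro k y w Z hw hy
    exact hy _ hw.wordProd_mem
  · intro k y u f w Z hu Z' ih hy
    have h1 := ih fun v hv => S.le_dist_letterMid_right f hv
    rw [← mul_wordProd_split] at h1
    have h2 := S.le_dist_end Z hu
    have h3 := Z.step u f w rfl hu
    have := S.le_L
    linarith

theorem countP_mul_le (S : LongExtension x M s a m h A ℓ₀ τ L) {k : G} {y : X}
    {w : List (Fin n × Bool)} (Z : State x M s a m h L k y w) :
    (w.countP (fun l => l.1 = a) : ℝ) * (L - (τ + 4)) ≤ dist y ((k * wordProd M w) • x) := by
  have hcount : ∀ u : List (Fin n × Bool), ReducedOver s u → u.countP (fun l => l.1 = a) = 0 := by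
    intro u hu
    rw [List.countP_eq_zero]
    intro l hl hla
    have := hu.mem l hl
    rw [of_decide_eq_true hla] at this
    exact S.notMem this
  refine S.state_induction (motive := fun k y w =>
    (w.countP (fun l => l.1 = a) : ℝ) * (L - (τ + 4)) ≤ dist y ((k * wordProd M w) • x)) ?_ ?_ Z
  · intro k y w Z hw
    rw [hcount w hw]
    simp
  · intro k y u f w Z hu Z' ih
    rw [← mul_wordProd_split] at ih
    have h2 := S.le_dist_end Z hu
    have h3 := Z.step u f w rfl hu
    rw [List.countP_append, hcount u hu, List.countP_cons]
    simp only [decide_true, if_true, zero_add]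
    push_cast
    linarith

/-- The first `a`-midpoint is at distance at least `h - 1` from either end of the path, and the
backtracking there costs at most `τ + 4`. This leaves `2 * h - (τ + 6)`, and no letter is longer
than `2 * h`. -/
theorem dominatesLetters (S : LongExtension x M s a m h A ℓ₀ τ L) {B : ℝ}
    (hB : DominatesLetters x M s B) : DominatesLetters x M (insert a s) (max B (τ + 6)) := by
  intro w hw l hl
  rcases hw.split with hw' | ⟨u, f, w', rfl, hu⟩
  · have := hB w hw' l hl
    have := le_max_left B (τ + 6)
    linarith
  · have hd : displacement x (M l.1) ≤ 2 * h := by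
      rcases hw.mem l hl with h' | h'
      · rw [h', S.displacement_eq]
      · exact S.displacement_le _ h'
    have h1 := S.le_dist_end (S.initial_state 1 hw) hu
    have h2 := S.half_le_dist_end (S.next_state (k := 1) hw)
      fun v hv => S.le_dist_letterMid_right f hv
    have h3 := S.le_dist_letterMid (k := 1) f hu.wordProd_mem (one_mem (subtupleSubgroup M s))
    rw [← mul_wordProd_split] at h2
    rw [mul_one] at h3
    rw [dist_smul_mul_smul] at h1
    have := le_max_right B (τ + 6)
    linarith

theorem linearGrowth (S : LongExtension x M s a m h A ℓ₀ τ L) (hs : LinearGrowth x M s) :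
    LinearGrowth x M (insert a s) := by
  obtain ⟨ε, hε, C, hC, hs⟩ := hs
  have hh := S.h_nonneg
  have hτ := S.τ_nonneg
  set C' := C + 2 * h + (τ + 4) with hC'
  have hpos : 0 < 1 + ε + C' := by linarith
  set η := ε / (1 + ε + C') with hη
  have hη0 : 0 < η := div_pos hε hpos
  have hηε : η ≤ ε := div_le_self hε.le (by linarith)
  refine ⟨η, hη0, C + h, by linarith, fun w hw => ?_⟩
  rw [← dist_smul_mul_smul x 1]
  refine S.state_induction (motive := fun k y w =>
    η * w.length - (C + h) ≤ dist y ((k * wordProd M w) • x)) ?_ ?_ (S.initial_state 1 hw)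
  · intro k y w Z hw
    have h1 := hs w hw
    rw [← dist_smul_mul_smul x k] at h1
    have h2 := dist_triangle (k • x) y ((k * wordProd M w) • x)
    have h3 := Z.near
    rw [dist_comm] at h3
    have h4 : η * w.length ≤ ε * w.length := by gcongr
    linarith
  · intro k y u f w Z hu Z' ih
    rw [← mul_wordProd_split] at ih
    have h1 := hs u hu
    rw [← dist_smul_mul_smul x k] at h1
    have h2 := S.le_dist_end Z hu
    have h3 := Z.step u f w rfl hu
    have h4 := dist_triangle4 (k • x) y ((k * wordProd M u) • letterMid M a m f)
      ((k * wordProd M u) • x)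
    rw [S.dist_frame, dist_comm (k • x) y] at h4
    have h5 := Z.near
    have h6 := S.le_L
    set D := dist y ((k * wordProd M u) • letterMid M a m f)
    -- A block gains at least 1 and at least `ε * u.length - C'`. Weighting these bounds by `ε + C'`
    -- and 1 gives `ε * (u.length + 1)`, which explains the denominator of `η`.
    have key : η * (u.length + 1) ≤ D - (τ + 4) := by
      rw [hη, div_mul_eq_mul_div, div_le_iff₀ hpos]
      have e1 : ε * u.length - C' ≤ D - (τ + 4) := by linarith
      have e2 : 1 ≤ D - (τ + 4) := by linarith
      nlinarith
    simp only [List.length_append, List.length_cons]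
    push_cast
    linarith

end LongExtension

end States

/-! ### Passing the properties to the enlarged set of letters -/

/-- If `z` lies on a geodesic from `p` to `t`, at a position between those of `y` and `y'`, and `y'`
is close to the geodesic, then `z` is close to a geodesic from `y` to `y'`. -/
theorem FourPoint.excess_between {X : Type*} [MetricSpace X] (H : FourPoint X) {p t y y' z : X}
    {κ : ℝ} (hκ : 0 ≤ κ) (hz : excess p t z ≤ 0) (h1 : dist p y ≤ dist p z)
    (h2 : dist p z ≤ dist p y') (h3 : excess p t y' ≤ κ) : excess y y' z ≤ 24 + 2 * κ := by
  have e1 : excess y t z ≤ 8 := by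
    rcases H.thin hz y with h | h
    · have : dist z y ≤ 4 := by unfold excess at h; linarith
      refine excess_le_of_left.trans ?_
      rw [dist_comm]; linarith
    · linarith
  have t1 := dist_triangle p z t
  rcases H.thin e1 y' with h | h
  · linarith
  · have : dist y' z ≤ 12 + κ := by unfold excess at *; linarith
    rw [excess_comm]
    refine excess_le_of_left.trans ?_
    linarith

namespace LongExtension

variable {X G : Type*} [MetricSpace X] [Group G] [MulAction G X] [IsIsometricSMul G X] {n : ℕ}
  {x : X} {M : Fin n → G} {s : Set (Fin n)} {a : Fin n} {m : X} {h A ℓ₀ τ L : ℝ}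

theorem excess_next_le (S : LongExtension x M s a m h A ℓ₀ τ L) {k : G} {y : X}
    {u w : List (Fin n × Bool)} {f : Bool} (Z : State x M s a m h L k y (u ++ (a, f) :: w))
    (hu : ReducedOver s u) {p : X} (hp : ∀ q, Anchored x M s h k q → excess p q y ≤ τ + 4)
    {q : X} (hq : Anchored x M s h (k * wordProd M u * letterVal M (a, f)) q) :
    excess p q ((k * wordProd M u) • letterMid M a m f) ≤ τ + 4 := by
  have hlong := Z.step u f w rfl hu
  have := S.le_L
  exact (S.four.excess_le_of_long (hp _ (S.anchored_mid k f hu)) (S.excess_le hu Z.anchored hq)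
    (by linarith)).2

/-- The first alternative covers the half letter between the midpoint `y` and the end `k • x` of the
letter just read; one step earlier in the induction it is absorbed into that letter. -/
theorem tracksLetters_aux (S : LongExtension x M s a m h A ℓ₀ τ L) {k : G} {y : X}
    {w : List (Fin n × Bool)} (Z : State x M s a m h L k y w) {p z : X}
    (hp : ∀ q, Anchored x M s h k q → excess p q y ≤ τ + 4)
    (hz : excess p ((k * wordProd M w) • x) z ≤ 0) (hyz : dist p y ≤ dist p z) :
    excess y (k • x) z ≤ A + 2 * τ + 56 ∨ ∃ v l r, w = v ++ l :: r ∧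
      excess ((k * wordProd M v) • x) ((k * wordProd M v * letterVal M l) • x) z ≤
        A + 2 * τ + 56 := by
  have hA := S.A_nonneg
  have hτ := S.τ_nonneg
  revert p
  refine S.state_induction (motive := fun k y w => ∀ {p : X},
    (∀ q, Anchored x M s h k q → excess p q y ≤ τ + 4) →
    excess p ((k * wordProd M w) • x) z ≤ 0 → dist p y ≤ dist p z →
    excess y (k • x) z ≤ A + 2 * τ + 56 ∨ ∃ v l r, w = v ++ l :: r ∧
      excess ((k * wordProd M v) • x) ((k * wordProd M v * letterVal M l) • x) z ≤
        A + 2 * τ + 56) ?_ ?_ Z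
  · intro k y w Z hw p hp hz hyz
    have h1 : excess y ((k * wordProd M w) • x) z ≤ 24 := by
      have := S.four.excess_between (y' := (k * wordProd M w) • x) le_rfl hz hyz
        (by unfold excess at hz; linarith [dist_nonneg (x := z) (y := (k * wordProd M w) • x)])
        (by unfold excess; simp)
      linarith
    rcases S.four.thin h1 (k • x) with h2 | h2
    · left; linarith
    · rcases S.tracks.coarse S.four S.between hw h2 with ⟨rfl, h3⟩ | ⟨v, l, r, rfl, h3⟩
      · left
        rw [excess_comm]
        refine excess_le_of_left.trans ?_
        rw [dist_comm]; linarith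
      · exact Or.inr ⟨v, l, r, rfl, by linarith⟩
  · intro k y u f w Z hu Z' ih p hp hz hyz
    have hp' := fun q hq => S.excess_next_le Z hu hp (q := q) hq
    by_cases hpos : dist p ((k * wordProd M u) • letterMid M a m f) ≤ dist p z
    · rw [mul_wordProd_split] at hz
      right
      rcases ih hp' hz hpos with h1 | ⟨v, l, r, rfl, h1⟩
      · refine ⟨u, (a, f), w, rfl, ?_⟩
        have e1 := S.dist_frame (k * wordProd M u) f
        have e2 := S.dist_frame_right (k * wordProd M u) f
        have e3 := dist_smul_mul_smul x (k * wordProd M u) (letterVal M (a, f))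
        rw [displacement_letterVal, S.displacement_eq] at e3
        have e4 := dist_triangle ((k * wordProd M u) • x)
          ((k * wordProd M u) • letterMid M a m f) z
        rw [dist_comm _ ((k * wordProd M u) • x)] at e1
        unfold excess at h1 ⊢
        linarith
      · refine ⟨u ++ (a, f) :: v, l, r, by simp, ?_⟩
        rwa [mul_wordProd_split]
    · have h1 := S.excess_end_le Z' le_rfl hp'
      rw [← mul_wordProd_split] at h1
      have h2 := S.four.excess_between (by linarith) hz hyz (le_of_not_ge hpos) h1
      -- Here `z` belongs to the current block: half a letter, a word over `s`, half a letter. The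
      -- excess `2 * τ + 40` over the block grows by 8 in `quad` and by `A + 8` in
      -- `TracksLetters.coarse`.
      rcases S.four.quad h2 (k • x) ((k * wordProd M u) • x) with h3 | h3 | h3
      · left; linarith
      · right
        rcases S.tracks.coarse S.four S.between hu h3 with ⟨rfl, h4⟩ | ⟨v, l, r, rfl, h4⟩
        · refine ⟨[], (a, f), w, rfl, excess_le_of_left.trans ?_⟩
          rw [wordProd_nil, mul_one, dist_comm]
          linarith
        · exact ⟨v, l, r ++ (a, f) :: w, by simp, by linarith⟩
      · right
        refine ⟨u, (a, f), w, rfl, ?_⟩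
        have e1 := S.dist_frame (k * wordProd M u) f
        have e2 := S.dist_frame_right (k * wordProd M u) f
        have e3 := dist_smul_mul_smul x (k * wordProd M u) (letterVal M (a, f))
        rw [displacement_letterVal, S.displacement_eq] at e3
        have e4 := dist_triangle z ((k * wordProd M u) • letterMid M a m f)
          ((k * wordProd M u * letterVal M (a, f)) • x)
        rw [dist_comm ((k * wordProd M u) • letterMid M a m f)] at e1
        unfold excess at h3 ⊢
        linarith

theorem tracksLetters (S : LongExtension x M s a m h A ℓ₀ τ L) :
    TracksLetters x M (insert a s) (A + 2 * τ + 56) := by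
  intro k w z hw hne hz
  have hτ := S.τ_nonneg
  have := S.tracksLetters_aux (S.initial_state k hw) (p := k • x) (z := z)
    (fun q _ => by
      refine excess_le_of_left.trans ?_
      rw [dist_self]; linarith) hz (by rw [dist_self]; exact dist_nonneg)
  rcases this with h1 | h1
  · obtain ⟨l, r, rfl⟩ := List.exists_cons_of_ne_nil hne
    refine ⟨[], l, r, rfl, excess_le_of_left.trans ?_⟩
    rw [excess_self] at h1
    simpa using h1
  · exact h1

/-- The points of `[z₁, z₂]` at distances `β₁` and `β₂` from `p` have excess at most `2 * τ + 40`
over the block from `y` to `y'`, so `holdsOften` for the block transfers to them. The transfer costs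
`2 * τ + 56` in `c`, and the required length adds up to `2 * c + ℓ + 6 * τ + 200`. -/
theorem exists_mem_block (S : LongExtension x M s a m h A ℓ₀ τ L) {c ℓ : ℝ} (hc : 0 ≤ c)
    (hℓ : 0 ≤ ℓ) (V : VisitsOrbit x M s (c + 2 * τ + 80) ℓ) {k : G} {p t y y' z₁ z₂ : X}
    (hy : Anchored x M s h k y) (hy' : Anchored x M s h k y') (hpy' : excess p t y' ≤ τ + 8)
    (hz : dist p z₁ + dist z₁ z₂ + dist z₂ t ≤ dist p t)
    {β₁ β₂ : ℝ} (hz₁ : dist p z₁ ≤ β₁) (hz₂ : β₂ ≤ dist p z₂) (hβ₁ : dist p y ≤ β₁)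
    (hβ₂ : β₂ ≤ dist p y') (hlen : β₁ + (2 * c + ℓ + 6 * τ + 200) ≤ β₂) :
    ∃ z, excess z₁ z₂ z ≤ 0 ∧ Anchored x M (insert a s) (h - c) k z := by
  have hτ := S.τ_nonneg
  have t1 := dist_triangle p z₁ z₂
  have t2 := dist_triangle p z₂ t
  obtain ⟨p₂, a1, a2⟩ := S.between z₁ z₂ (β₂ - dist p z₁) (by linarith) (by linarith)
  have t3 := dist_triangle p z₁ p₂
  have t4 := dist_triangle p p₂ z₂
  have t5 := dist_triangle p₂ z₂ t
  have t6 := dist_triangle p p₂ t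
  obtain ⟨p₁, b1, b2⟩ := S.between z₁ p₂ (β₁ - dist p z₁) (by linarith) (by linarith)
  have t7 := dist_triangle p z₁ p₁
  have t8 := dist_triangle p p₁ p₂
  have t9 := dist_triangle p₁ p₂ t
  have e₁ : excess y y' p₁ ≤ 2 * τ + 40 :=
    (S.four.excess_between (κ := τ + 8) (by linarith) (by unfold excess; linarith) (by linarith)
      (by linarith) hpy').trans (by linarith)
  have e₂ : excess y y' p₂ ≤ 2 * τ + 40 :=
    (S.four.excess_between (κ := τ + 8) (by linarith) (by unfold excess; linarith) (by linarith)
      (by linarith) hpy').trans (by linarith)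
  have h1 := S.holdsOften (c := c + 2 * τ + 56) (by linarith) hℓ
    (by rw [show c + 2 * τ + 56 + 24 = c + 2 * τ + 80 by ring]; exact V) hy hy'
  obtain ⟨z, w, hz, ⟨v, hv, hw⟩, hzw⟩ := h1.coarse S.four S.between e₁ e₂ (by linarith)
  refine ⟨z, ?_, Anchored.mono (s := s) (r := h - c) ⟨v, hv, ?_⟩ (Set.subset_insert _ _) le_rfl⟩
  · have u1 := dist_triangle z₁ p₁ z
    have u2 := dist_triangle z p₂ z₂
    unfold excess at *
    linarith
  · have := dist_triangle z w ((k * v) • x)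
    linarith

/-- A subsegment that contains a long part of the geodesic after `y` comes close to the orbit. -/
theorem visitsOrbit_first (S : LongExtension x M s a m h A ℓ₀ τ L) {c ℓ : ℝ} (hc : 0 ≤ c)
    (hℓ : 0 ≤ ℓ) (V : VisitsOrbit x M s (c + 2 * τ + 80) ℓ)
    (hL : 2 * c + ℓ + 7 * τ + 204 ≤ L) {k : G} {y : X}
    {w : List (Fin n × Bool)} (Z : State x M s a m h L k y w) {p z₁ z₂ : X}
    (hp : ∀ q, Anchored x M s h k q → excess p q y ≤ τ + 4)
    (hz : dist p z₁ + dist z₁ z₂ + dist z₂ ((k * wordProd M w) • x) ≤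
      dist p ((k * wordProd M w) • x))
    (h₁ : dist p z₁ ≤ dist p y) (h₂ : dist p y + (2 * c + ℓ + 6 * τ + 200) ≤ dist p z₂) :
    ∃ z, excess z₁ z₂ z ≤ 0 ∧ Anchored x M (insert a s) (h - c) k z := by
  have hτ := S.τ_nonneg
  rcases Z.reduced.split with hw | ⟨u, f, w', rfl, hu⟩
  · refine S.exists_mem_block hc hℓ V Z.anchored (S.anchored_end k hw) ?_ hz h₁ le_rfl le_rfl ?_ h₂
    · unfold excess; simp; linarith
    · have := dist_triangle p z₁ z₂
      have := dist_nonneg (x := z₂) (y := (k * wordProd M w) • x)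
      linarith
  · have Z' := S.next_state (k := k) Z.reduced
    have h3 := S.excess_end_le Z' le_rfl fun q hq => S.excess_next_le Z hu hp (q := q) hq
    rw [← mul_wordProd_split] at h3
    have h4 := hp _ (S.anchored_mid k f hu)
    have h5 := Z.step u f w' rfl hu
    refine S.exists_mem_block hc hℓ V Z.anchored (S.anchored_mid k f hu) (by linarith) hz h₁
      (min_le_right _ _) le_rfl (min_le_left _ _) (le_min ?_ h₂)
    unfold excess at h4
    linarith

theorem visitsOrbit_aux (S : LongExtension x M s a m h A ℓ₀ τ L) {c ℓ : ℝ} (hc : 0 ≤ c)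
    (hℓ : 0 ≤ ℓ) (V : VisitsOrbit x M s (c + 2 * τ + 80) ℓ)
    (hL : 2 * c + ℓ + 7 * τ + 204 ≤ L) {k : G} {y : X}
    {w : List (Fin n × Bool)} (Z : State x M s a m h L k y w) {p z₁ z₂ : X}
    (hp : ∀ q, Anchored x M s h k q → excess p q y ≤ τ + 4)
    (hz : dist p z₁ + dist z₁ z₂ + dist z₂ ((k * wordProd M w) • x) ≤
      dist p ((k * wordProd M w) • x))
    (h₁ : dist p y ≤ dist p z₁) (h₂ : 2 * (2 * c + ℓ + 6 * τ + 200) ≤ dist z₁ z₂) :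
    ∃ z, excess z₁ z₂ z ≤ 0 ∧ Anchored x M (insert a s) (h - c) k z := by
  have hτ := S.τ_nonneg
  revert p
  refine S.state_induction (motive := fun k y w => ∀ {p : X},
    (∀ q, Anchored x M s h k q → excess p q y ≤ τ + 4) →
    dist p z₁ + dist z₁ z₂ + dist z₂ ((k * wordProd M w) • x) ≤
      dist p ((k * wordProd M w) • x) → dist p y ≤ dist p z₁ →
    ∃ z, excess z₁ z₂ z ≤ 0 ∧ Anchored x M (insert a s) (h - c) k z) ?_ ?_ Z
  · intro k y w Z hw p hp hz h₁
    have t1 := dist_triangle p z₁ z₂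
    have t2 := dist_triangle p z₂ ((k * wordProd M w) • x)
    refine S.exists_mem_block hc hℓ V Z.anchored (S.anchored_end k hw) ?_ hz le_rfl le_rfl h₁ ?_
      (by linarith)
    · unfold excess; simp; linarith
    · have := dist_nonneg (x := z₂) (y := (k * wordProd M w) • x)
      linarith
  · intro k y u f w Z hu Z' ih p hp hz h₁
    have t1 := dist_triangle p z₁ z₂
    have t2 := dist_triangle p z₂ ((k * wordProd M (u ++ (a, f) :: w)) • x)
    have hp' := fun q hq => S.excess_next_le Z hu hp (q := q) hq
    have h3 := S.excess_end_le Z' le_rfl hp'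
    have frame : ∀ z, Anchored x M (insert a s) (h - c)
        (k * wordProd M u * letterVal M (a, f)) z → Anchored x M (insert a s) (h - c) k z := by
      intro z hz
      rw [mul_assoc] at hz
      exact hz.of_mul (mul_mem (wordProd_mem fun l hl => Or.inr (hu.mem l hl))
        (letterVal_mem (Or.inl rfl)))
    by_cases hpos : dist p ((k * wordProd M u) • letterMid M a m f) ≤ dist p z₁
    · rw [mul_wordProd_split] at hz
      obtain ⟨z, hz, hanch⟩ := ih hp' hz hpos
      exact ⟨z, hz, frame z hanch⟩
    -- The segment has twice the length needed inside one block. Either the current block contains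
    -- enough of it, or it reaches far enough past the next midpoint for `visitsOrbit_first`, the
    -- following block being long.
    by_cases hlen : dist p z₁ + (2 * c + ℓ + 6 * τ + 200) ≤
        dist p ((k * wordProd M u) • letterMid M a m f)
    · rw [← mul_wordProd_split] at h3
      exact S.exists_mem_block hc hℓ V Z.anchored (S.anchored_mid k f hu) (by linarith) hz le_rfl
        (min_le_right _ _) h₁ (min_le_left _ _) (le_min hlen (by linarith))
    · rw [mul_wordProd_split] at hz t2
      obtain ⟨z, hz, hanch⟩ := S.visitsOrbit_first hc hℓ V hL Z' hp' hz (by linarith) (by linarith)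
      exact ⟨z, hz, frame z hanch⟩

theorem visitsOrbit (S : LongExtension x M s a m h A ℓ₀ τ L) {c ℓ : ℝ} (hc : 0 ≤ c)
    (hℓ : 0 ≤ ℓ) (V : VisitsOrbit x M s (c + 2 * τ + 80) ℓ)
    (hL : 2 * c + ℓ + 7 * τ + 204 ≤ L) :
    VisitsOrbit x M (insert a s) c (2 * (2 * c + ℓ + 6 * τ + 200)) := by
  intro k w hw z₁ z₂ hz hlen
  have hτ := S.τ_nonneg
  obtain ⟨z, hz, v, hv, hd⟩ := S.visitsOrbit_aux hc hℓ V hL (S.initial_state k hw) (p := k • x)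
    (fun q _ => by
      refine excess_le_of_left.trans ?_
      rw [dist_self]; linarith) hz (by rw [dist_self]; exact dist_nonneg) hlen
  refine ⟨z, hz, v, hv, a, Or.inl rfl, ?_⟩
  rw [S.displacement_eq]
  linarith

/-- Powers of a cyclically reduced word stay reduced, so if the word contains an `a`-letter its
`N`-th power displaces `x` by at least `N * (L - (τ + 4))`. Dividing by `N` bounds the displacement
of every point; the bound is invariant under conjugation, which reduces the general case to this
one. -/
theorem movesPoints (S : LongExtension x M s a m h A ℓ₀ τ L) :
    MovesPoints X M (insert a s) (L - (τ + 4)) := by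
  have hτ := S.τ_nonneg
  have hL := S.le_L
  have cyc : ∀ c : List (Fin n × Bool), FreeGroup.IsCyclicallyReduced c →
      ReducedOver (insert a s) c → c ≠ [] → ∀ z : X, L - (τ + 4) ≤ dist z (wordProd M c • z) := by
    intro c hc hcs hne z
    rcases hcs.split with hs | ⟨u, f, w', hsplit, hu⟩
    · linarith [S.moves c hs hne z]
    have bound : ∀ N : ℕ, (N : ℝ) * (L - (τ + 4)) ≤
        2 * dist x z + N * dist z (wordProd M c • z) := by
      intro N
      have hpow : ReducedOver (insert a s) (List.replicate N c).flatten := by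
        refine ⟨(hc.flatten_replicate N).isReduced, fun l hl => ?_⟩
        obtain ⟨c', hc', hl⟩ := List.mem_flatten.1 hl
        rw [List.eq_of_mem_replicate hc'] at hl
        exact hcs.mem l hl
      have h1 := S.countP_mul_le (S.initial_state 1 hpow)
      have hcount : N ≤ (List.replicate N c).flatten.countP fun l => l.1 = a := by
        rw [List.countP_flatten, List.map_replicate, List.sum_replicate, smul_eq_mul]
        refine Nat.le_mul_of_pos_right _ ?_
        rw [List.countP_pos_iff]
        exact ⟨(a, f), by rw [hsplit]; simp, by simp⟩
      have h2 : dist z (wordProd M c ^ N • z) ≤ N * dist z (wordProd M c • z) := by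
        clear h1 hpow hcount
        induction N with
        | zero => simp
        | succ N ih =>
          have := dist_triangle z (wordProd M c ^ N • z) (wordProd M c ^ (N + 1) • z)
          rw [pow_succ, mul_smul, dist_smul] at this
          rw [pow_succ, mul_smul]
          push_cast
          linarith
      have h3 := dist_triangle4 x z (wordProd M c ^ N • z) (wordProd M c ^ N • x)
      rw [dist_smul, dist_comm z x] at h3
      rw [wordProd_flatten_replicate, one_mul, one_smul] at h1
      have h4 : (N : ℝ) * (L - (τ + 4)) ≤
          ((List.replicate N c).flatten.countP fun l => l.1 = a : ℕ) * (L - (τ + 4)) := by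
        refine mul_le_mul_of_nonneg_right (by exact_mod_cast hcount) (by linarith)
      linarith
    by_contra! hlt
    obtain ⟨N, hN⟩ := exists_nat_gt (2 * dist x z / (L - (τ + 4) - dist z (wordProd M c • z)))
    rw [div_lt_iff₀ (by linarith)] at hN
    linarith [bound N]
  intro w hw hne z
  have hconj := FreeGroup.reduceCyclically.conj_conjugator_reduceCyclically w
  have hinf : FreeGroup.reduceCyclically w <:+: w := ⟨_, _, hconj⟩
  have hmk : FreeGroup.mk w = FreeGroup.mk (FreeGroup.reduceCyclically.conjugator w) *
      FreeGroup.mk (FreeGroup.reduceCyclically w) *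
      (FreeGroup.mk (FreeGroup.reduceCyclically.conjugator w))⁻¹ := by
    conv_lhs => rw [← hconj]
    rw [← FreeGroup.mul_mk, ← FreeGroup.mul_mk, FreeGroup.inv_mk]
  have hne' : FreeGroup.reduceCyclically w ≠ [] := by
    intro h0
    rw [h0, ← FreeGroup.one_eq_mk, mul_one, mul_inv_cancel] at hmk
    have := FreeGroup.toWord_mk (L₁ := w)
    rw [hmk, FreeGroup.toWord_one, hw.isReduced.reduce_eq] at this
    exact hne this.symm
  have hG := congrArg (FreeGroup.lift M) hmk
  simp only [map_mul, map_inv, lift_mk_eq_wordProd] at hG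
  have := cyc _ (FreeGroup.reduceCyclically.isCyclicallyReduced hw.isReduced) (hw.of_infix hinf)
    hne' ((wordProd M (FreeGroup.reduceCyclically.conjugator w))⁻¹ • z)
  rw [← dist_smul (wordProd M (FreeGroup.reduceCyclically.conjugator w)), smul_inv_smul,
    ← mul_smul, ← mul_smul, ← hG] at this
  exact this

end LongExtension

/-! ### Induction on the number of letters and choice of constants -/

section Induction

variable {X G : Type*} [MetricSpace X] [Group G] [MulAction G X] [IsIsometricSMul G X] {n : ℕ}
  {x : X} {M : Fin n → G}

theorem Dispersed.le_displacement {d : ℝ} (D : Dispersed x M d) (i : Fin n) :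
    d ≤ displacement x (M i) := by
  have := D.moves i 1 (one_mem _) 1 (one_mem _) x
  rwa [one_mul, mul_one] at this

/-- The distance is the displacement of `u⁻¹ * M a * v`, or for the inverse letter that of `v⁻¹ * M
a * u`; both lie in the double coset in which `M a` is almost shortest. -/
theorem Dispersed.sep {d : ℝ} (D : Dispersed x M d) {a : Fin n} {s : Set (Fin n)} (ha : a ∉ s)
    {u v : G} (hu : u ∈ subtupleSubgroup M s) (hv : v ∈ subtupleSubgroup M s) (f : Bool) :
    displacement x (M a) - 1 ≤ dist (u • x) ((letterVal M (a, f) * v) • x) := by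
  have hs : subtupleSubgroup M s ≤ subtupleSubgroup M {a}ᶜ :=
    Subgroup.closure_mono (Set.image_mono (by simpa using ha))
  cases f
  · have := D.short a v⁻¹ (inv_mem (hs hv)) u (hs hu)
    unfold displacement at this ⊢
    simp only [letterVal, Bool.false_eq_true, if_false]
    rw [← dist_smul v x ((v⁻¹ * M a * u) • x), mul_assoc, mul_smul, smul_inv_smul, dist_comm (v • x)] at this
    rw [← dist_smul (M a) (u • x), mul_smul, smul_inv_smul, ← mul_smul]
    linarith
  · have := D.short a u⁻¹ (inv_mem (hs hu)) v (hs hv)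
    unfold displacement at this ⊢
    simp only [letterVal, if_true]
    rw [← dist_smul u x ((u⁻¹ * M a * v) • x), mul_assoc, mul_smul, smul_inv_smul] at this
    linarith

theorem Dispersed.moves_letter {d : ℝ} (D : Dispersed x M d) {a : Fin n} {s : Set (Fin n)}
    (ha : a ∉ s) {u : G} (hu : u ∈ subtupleSubgroup M s) (f : Bool) (z : X) :
    d ≤ dist z ((letterVal M (a, f) * u) • z) := by
  have hs : subtupleSubgroup M s ≤ subtupleSubgroup M {a}ᶜ :=
    Subgroup.closure_mono (Set.image_mono (by simpa using ha))
  cases f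
  · have := D.moves a u⁻¹ (inv_mem (hs hu)) 1 (one_mem _) z
    rw [← dist_smul u, mul_one, mul_smul, smul_inv_smul, dist_comm] at this
    simp only [letterVal, Bool.false_eq_true, if_false]
    rwa [← dist_smul (M a), mul_smul, smul_inv_smul]
  · have := D.moves a 1 (one_mem _) u (hs hu) z
    rw [one_mul] at this
    simpa only [letterVal, if_true] using this

theorem reducedOver_empty {w : List (Fin n × Bool)} (hw : ReducedOver ∅ w) : w = [] :=
  List.eq_nil_iff_forall_not_mem.2 fun l hl => hw.mem l hl

theorem Dispersed.longExtension {A ℓ₀ L d : ℝ} (H : FourPoint X) (B : HasBetween X)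
    (D : Dispersed x M d) {s : Set (Fin n)} {a : Fin n} (ha : a ∉ s)
    (hmax : ∀ i ∈ s, displacement x (M i) ≤ displacement x (M a)) (hA : 0 ≤ A) (hℓ : 0 ≤ ℓ₀)
    (T : TracksLetters x M s A) (V : VisitsOrbit x M s (A / 2 + 42) ℓ₀) (P : MovesPoints X M s L)
    (hd : 2 * L + 2 ≤ d) (hL : 2 * (A + 72 + ℓ₀) + 8 ≤ L) :
    ∃ m, LongExtension x M s a m (displacement x (M a) / 2) A ℓ₀ (2 * (A + 72 + ℓ₀)) L := by
  have h0 := displacement_nonneg x (M a)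
  have h1 := D.le_displacement a
  obtain ⟨m, m1, m2⟩ := B x (M a • x) (displacement x (M a) / 2) (by linarith)
    (by unfold displacement at *; linarith)
  refine ⟨m, ?_⟩
  constructor
  · constructor
    · exact H
    · exact B
    · exact hA
    · exact hℓ
    · exact m1
    · rw [m2]; unfold displacement; ring
    · exact ha
    · ring
    · intro i hi
      linarith [hmax i hi]
    · exact T
    · exact V
    · intro u hu v hv f
      linarith [D.sep ha hu hv f]
  · rfl
  · exact P
  · intro f u hu z
    linarith [D.moves_letter ha hu f z]
  · linarith
  · exact hL

end Induction

universe u v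

/-- The order of the quantifiers matters. The backtracking bound `τ` needs orbit visits for the
smaller set only with the parameter `A / 2 + 42`, so `A` and `B` are fixed before `c`. A second use
of the hypothesis with `c + 2 * τ + 80` gives `ℓ`. Since `E` comes last, the block length `L` can
exceed everything found so far, and only `d` depends on it. All sets of size `k` are treated at once
because the longest letter to be removed depends on the action. -/
theorem exists_constants (n k : ℕ) : ∃ A B : ℝ, 0 ≤ A ∧ ∀ c : ℝ, 0 ≤ c →
    ∃ ℓ : ℝ, 0 < ℓ ∧ ∀ E : ℝ, ∃ d : ℝ,
      ∀ (X : Type u) [MetricSpace X] (G : Type v) [Group G] [MulAction G X] [IsIsometricSMul G X],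
        FourPoint X → HasBetween X → ∀ (x : X) (M : Fin n → G), Dispersed x M d →
        ∀ s : Finset (Fin n), s.card = k →
          TracksLetters x M s A ∧ DominatesLetters x M s B ∧ VisitsOrbit x M s c ℓ ∧
            MovesPoints X M s E ∧ LinearGrowth x M s := by
  induction k with
  | zero =>
    refine ⟨0, 0, le_rfl, fun c _ => ⟨1, one_pos, fun E => ⟨0, ?_⟩⟩⟩
    intro X _ G _ _ _ _ _ x M _ s hs
    obtain rfl := Finset.card_eq_zero.1 hs
    rw [Finset.coe_empty]
    refine ⟨?_, ?_, ?_, ?_, 1, one_pos, 0, le_rfl, ?_⟩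
    · intro k w z hw hne
      exact absurd (reducedOver_empty hw) hne
    · intro w hw l hl
      exact absurd (hw.mem l hl) (by simp)
    -- The geodesic is a single point, so no subsegment has length at least `ℓ = 1`.
    · intro k w hw z₁ z₂ h1 h2
      obtain rfl := reducedOver_empty hw
      rw [wordProd_nil, mul_one, dist_self] at h1
      linarith [dist_nonneg (x := k • x) (y := z₁), dist_nonneg (x := z₂) (y := k • x)]
    · intro w hw hne
      exact absurd (reducedOver_empty hw) hne
    · intro w hw
      obtain rfl := reducedOver_empty hw
      simpa using displacement_nonneg x _
  | succ k ih =>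
    obtain ⟨A, B, hA, ih⟩ := ih
    obtain ⟨ℓ₀, hℓ₀, ih₀⟩ := ih (A / 2 + 42) (by linarith)
    set τ := 2 * (A + 72 + ℓ₀) with hτ
    refine ⟨A + 2 * τ + 56, max B (τ + 6), by linarith, fun c hc => ?_⟩
    obtain ⟨ℓ, hℓ, ih₁⟩ := ih (c + 2 * τ + 80) (by linarith)
    refine ⟨2 * (2 * c + ℓ + 6 * τ + 200), by linarith, fun E => ?_⟩
    set L := max (E + (τ + 4)) (max (τ + 8) (2 * c + ℓ + 7 * τ + 204)) with hL
    have hL1 : E + (τ + 4) ≤ L := le_max_left _ _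
    have hL2 : τ + 8 ≤ L := (le_max_left _ _).trans (le_max_right _ _)
    have hL3 : 2 * c + ℓ + 7 * τ + 204 ≤ L := (le_max_right _ _).trans (le_max_right _ _)
    obtain ⟨d₀, ih₀⟩ := ih₀ L
    obtain ⟨d₁, ih₁⟩ := ih₁ L
    refine ⟨max d₀ (max d₁ (2 * L + 2)), ?_⟩
    intro X _ G _ _ _ H Btw x M D s hs
    obtain ⟨a, ha, hmax⟩ := s.exists_max_image (fun i => displacement x (M i))
      (Finset.card_pos.1 (by omega))
    have hcard : (s.erase a).card = k := by rw [Finset.card_erase_of_mem ha, hs]; rfl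
    obtain ⟨T, Dom, V₀, P, Lin⟩ := ih₀ X G H Btw x M (D.mono (le_max_left _ _)) _ hcard
    obtain ⟨-, -, V₁, -, -⟩ := ih₁ X G H Btw x M
      (D.mono ((le_max_left _ _).trans (le_max_right _ _))) _ hcard
    obtain ⟨m, S⟩ := (D.mono ((le_max_right _ _).trans (le_max_right _ _))).longExtension H Btw
      (s := ↑(s.erase a)) (a := a) (by simp) (fun i hi => hmax i (by
        simp only [Finset.coe_erase, Set.mem_sdiff, Finset.mem_coe] at hi; exact hi.1))
      hA hℓ₀.le T V₀ P le_rfl hL2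
    rw [← hτ] at S
    have hins : (s : Set (Fin n)) = insert a ↑(s.erase a) := by
      rw [← Finset.coe_insert, Finset.insert_erase ha]
    rw [hins]
    refine ⟨S.tracksLetters, S.dominatesLetters Dom, S.visitsOrbit hc hℓ.le V₁ hL3, ?_,
      S.linearGrowth Lin⟩
    intro w hw hne z
    linarith [S.movesPoints w hw hne z]

/-! ### From the inductive properties to the conclusions (1) to (4) -/

section Conclusions

variable {X G : Type*} [MetricSpace X] [Group G] [MulAction G X] [IsIsometricSMul G X] {n : ℕ}
  {x : X} {M : Fin n → G}

theorem subtupleSubgroup_univ (M : Fin n → G) :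
    subtupleSubgroup M (Set.univ : Set (Fin n)) = tupleSubgroup M := by
  rw [subtupleSubgroup, tupleSubgroup, Set.image_univ]

theorem exists_reduced_of_mem {u : G} (hu : u ∈ tupleSubgroup M) :
    ∃ w, ReducedOver Set.univ w ∧ wordProd M w = u :=
  exists_reducedOver (by rwa [subtupleSubgroup_univ])

theorem reducedOver_univ {w : List (Fin n × Bool)} (hw : FreeGroup.IsReduced w) :
    ReducedOver Set.univ w := ⟨hw, fun _ _ => Set.mem_univ _⟩

theorem wordProd_mem_tupleSubgroup (M : Fin n → G) (w : List (Fin n × Bool)) :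
    wordProd M w ∈ tupleSubgroup M := by
  rw [← subtupleSubgroup_univ]
  exact wordProd_mem fun _ _ => Set.mem_univ _

theorem smul_mem_orbit {u : G} (hu : u ∈ tupleSubgroup M) :
    u • x ∈ MulAction.orbit (tupleSubgroup M) x := ⟨⟨u, hu⟩, rfl⟩

theorem freelyGenerates_of_movesPoints (x : X) {E : ℝ} (hE : 0 < E)
    (P : MovesPoints X M Set.univ E) : FreelyGenerates M := by
  rw [FreelyGenerates, injective_iff_map_eq_one]
  intro g hg
  by_contra hne
  have h1 := P g.toWord (reducedOver_univ FreeGroup.isReduced_toWord)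
    (fun h => hne (FreeGroup.toWord_eq_nil_iff.1 h)) x
  rw [← lift_mk_eq_wordProd, FreeGroup.mk_toWord, hg, one_smul, dist_self] at h1
  linarith

theorem displacement_wordProd_le {T : ℝ} (hT : ∀ i, displacement x (M i) ≤ T)
    (w : List (Fin n × Bool)) : displacement x (wordProd M w) ≤ T * w.length := by
  induction w with
  | nil => simp [displacement]
  | cons l w ih =>
    have h1 := dist_triangle x (letterVal M l • x) ((letterVal M l * wordProd M w) • x)
    rw [dist_smul_mul_smul] at h1
    have h2 := displacement_letterVal x M l
    have h3 := hT l.1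
    rw [wordProd_cons, List.length_cons]
    push_cast
    unfold displacement at *
    linarith

theorem isQuasiIsometricEmbedding_of_linearGrowth (hM : LinearGrowth x M Set.univ) :
    IsQuasiIsometricEmbedding (wordDist M) (fun u : tupleSubgroup M => (u : G) • x) := by
  obtain ⟨ε, hε, C, hC, hM⟩ := hM
  set T := ∑ i, displacement x (M i) with hT
  have hT0 : ∀ i, displacement x (M i) ≤ T := fun i =>
    Finset.single_le_sum (fun j _ => displacement_nonneg x (M j)) (Finset.mem_univ i)
  have hK1 : 1 ≤ max 1 (max (1 / ε) T) := le_max_left _ _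
  have hK2 : 1 / ε ≤ max 1 (max (1 / ε) T) := (le_max_left _ _).trans (le_max_right _ _)
  have hK3 : T ≤ max 1 (max (1 / ε) T) := (le_max_right _ _).trans (le_max_right _ _)
  refine ⟨max 1 (max (1 / ε) T), C, hK1, hC, ?_⟩
  generalize max 1 (max (1 / ε) T) = K at hK1 hK2 hK3
  intro u v
  have huv : (u : G)⁻¹ * v ∈ tupleSubgroup M := mul_mem (inv_mem u.2) v.2
  have hdist : dist ((u : G) • x) ((v : G) • x) = displacement x ((u : G)⁻¹ * v) := by
    unfold displacement
    rw [← dist_smul (u : G) x, mul_smul, smul_inv_smul]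
  simp only [hdist, wordDist]
  obtain ⟨w, hw, hwu⟩ := exists_reduced_of_mem huv
  have hmem : wordLength M ((u : G)⁻¹ * v) ∈
      {k | ∃ w : List (Fin n × Bool), w.length = k ∧ wordProd M w = (u : G)⁻¹ * v} :=
    Nat.sInf_mem ⟨w.length, w, rfl, hwu⟩
  constructor
  · have h1 : wordLength M ((u : G)⁻¹ * v) ≤ w.length := Nat.sInf_le ⟨w, rfl, hwu⟩
    have h2 := hM w hw
    rw [hwu] at h2
    have h3 : (wordLength M ((u : G)⁻¹ * v) : ℝ) / K ≤ ε * w.length := by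
      rw [div_le_iff₀ (by linarith)]
      have h4 : 1 ≤ ε * K := by
        rw [div_le_iff₀ hε] at hK2
        linarith
      have h5 : (wordLength M ((u : G)⁻¹ * v) : ℝ) ≤ w.length := by exact_mod_cast h1
      calc (wordLength M ((u : G)⁻¹ * v) : ℝ) ≤ 1 * w.length := by linarith
        _ ≤ ε * K * w.length := by gcongr
        _ = ε * w.length * K := by ring
    linarith
  · obtain ⟨w', hw', hwu'⟩ := hmem
    have h1 := displacement_wordProd_le hT0 w'
    rw [hwu', hw'] at h1
    have : T * (wordLength M ((u : G)⁻¹ * v) : ℝ) ≤ K * wordLength M ((u : G)⁻¹ * v) := by gcongr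
    linarith

/-- Each letter that survives the reduction of `w` comes from a letter of `w` that is preceded by
the same group element. -/
theorem exists_prefix_of_red (M : Fin n → G) {w w' : List (Fin n × Bool)}
    (h : FreeGroup.Red w w') {p r : List (Fin n × Bool)} {l : Fin n × Bool}
    (hw' : w' = p ++ l :: r) : ∃ p' r', w = p' ++ l :: r' ∧ wordProd M p' = wordProd M p := by
  induction h generalizing p r with
  | refl => exact ⟨p, r, hw', rfl⟩
  | tail _ hstep ih =>
    obtain @⟨L₁, L₂, i, b⟩ := hstep
    have hcancel : letterVal M (i, b) * letterVal M (i, !b) = 1 := by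
      rw [letterVal_not, mul_inv_cancel]
    rcases List.append_eq_append_iff.1 hw' with ⟨q, rfl, hq⟩ | ⟨q, rfl, hq⟩
    · obtain ⟨p', r', h1, h2⟩ := ih (p := L₁ ++ (i, b) :: (i, !b) :: q) (r := r) (by simp [hq])
      refine ⟨p', r', h1, ?_⟩
      rw [h2]
      simp [← mul_assoc (letterVal M (i, b)), hcancel]
    · cases q with
      | nil =>
        simp only [List.nil_append] at hq
        obtain ⟨p', r', h1, h2⟩ := ih (p := p ++ [(i, b), (i, !b)]) (r := r)
          (by simp [← hq])
        refine ⟨p', r', h1, ?_⟩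
        rw [h2]
        simp [hcancel]
      | cons l' q =>
        simp only [List.cons_append, List.cons.injEq] at hq
        obtain ⟨rfl, rfl⟩ := hq
        exact ih (p := p) (r := q ++ (i, b) :: (i, !b) :: L₂) (by simp)

/-- Tracking is known for reduced words only. A letter of the reduction also occurs in `w` after a
prefix with the same value, so its segment is part of the path of `w`. If everything cancels, the
segment is the point `x`. -/
theorem mem_nbhd_concatPath (H : FourPoint X) {A r : ℝ} (hA : 0 ≤ A) (hr : A / 2 + 4 ≤ r)
    (T : TracksLetters x M Set.univ A) {w : List (Fin n × Bool)} (hw : w ≠ []) {S : Set X}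
    (hS : IsGeodesicSegment S x (wordProd M w • x)) {I : Fin w.length → Set X}
    (hI : ∀ j, IsGeodesicSegment (I j) x (letterVal M (w.get j) • x)) :
    S ⊆ nbhd r (concatPath M w I) := by
  intro z hz
  have hz' := hS.dist_add hz
  by_cases hne : FreeGroup.reduce w = []
  · have h1 := wordProd_reduce M w
    rw [hne, wordProd_nil] at h1
    rw [← h1, one_smul, dist_self, dist_comm z x] at hz'
    have h0 : 0 < w.length := List.length_pos_iff.2 hw
    refine ⟨x, Set.mem_iUnion.2 ⟨⟨0, h0⟩, x, (hI _).left_mem, by simp⟩, ?_⟩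
    rw [dist_comm]; linarith
  · obtain ⟨p, l, q, hsplit, hp⟩ := T 1 (FreeGroup.reduce w) z
      (reducedOver_univ (isReduced_reduce w)) hne
      (by rw [wordProd_reduce, one_mul, one_smul]; unfold excess; linarith)
    obtain ⟨p', q', rfl, hpp⟩ := exists_prefix_of_red M FreeGroup.reduce.red hsplit
    have hlt : p'.length < (p' ++ l :: q').length := by simp
    have hj := hI ⟨p'.length, hlt⟩
    have hget : (p' ++ l :: q').get ⟨p'.length, hlt⟩ = l := by simp
    rw [hget] at hj
    obtain ⟨y, hy, hzy⟩ := H.exists_proj_mem hj ((wordProd M p)⁻¹ • z)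
    refine ⟨wordProd M p • y, Set.mem_iUnion.2 ⟨⟨p'.length, hlt⟩, y, hy, by simp [hpp]⟩, ?_⟩
    rw [← dist_smul (wordProd M p), smul_inv_smul] at hzy
    refine hzy.trans ?_
    have : excess x (letterVal M l • x) ((wordProd M p)⁻¹ • z) ≤ A := by
      refine le_trans (le_of_eq ?_) hp
      unfold excess
      rw [one_mul, mul_smul, dist_smul, ← dist_smul (wordProd M p) x,
        ← dist_smul (wordProd M p) ((wordProd M p)⁻¹ • z), smul_inv_smul]
    linarith

theorem mem_nbhd_orbit (hn : 0 < n) {A r : ℝ} (hA : 0 ≤ A) (hr : A / 2 ≤ r)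
    (T : TracksLetters x M Set.univ A) {u : G} (hu : u ∈ tupleSubgroup M) {S : Set X}
    (hS : IsGeodesicSegment S x (u • x)) :
    S ⊆ nbhd (⨆ i, (displacement x (M i) / 2 + r)) (MulAction.orbit (tupleSubgroup M) x) := by
  intro z hz
  have hz' := hS.dist_add hz
  have hsup : ∀ i, displacement x (M i) / 2 + r ≤ ⨆ i, (displacement x (M i) / 2 + r) :=
    le_ciSup (Set.finite_range _).bddAbove
  obtain ⟨w, hw, rfl⟩ := exists_reduced_of_mem hu
  rcases eq_or_ne w [] with rfl | hne
  · refine ⟨x, MulAction.mem_orbit_self x, ?_⟩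
    rw [wordProd_nil, one_smul, dist_self, dist_comm z x] at hz'
    have := hsup ⟨0, hn⟩
    have := displacement_nonneg x (M ⟨0, hn⟩)
    rw [dist_comm]
    linarith
  · obtain ⟨p, l, q, rfl, hp⟩ := T 1 w z hw hne
      (by rw [one_mul, one_smul]; unfold excess; linarith)
    have h1 := hsup l.1
    have h2 := dist_smul_mul_smul x (1 * wordProd M p) (letterVal M l)
    rw [displacement_letterVal] at h2
    unfold excess at hp
    rw [dist_comm _ z] at hp
    by_cases h3 : dist z ((1 * wordProd M p) • x) ≤ displacement x (M l.1) / 2 + r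
    · rw [one_mul] at h3
      exact ⟨_, smul_mem_orbit (wordProd_mem_tupleSubgroup M p), h3.trans h1⟩
    · refine ⟨(1 * wordProd M p * letterVal M l) • x, smul_mem_orbit ?_, by linarith⟩
      have := wordProd_mem_tupleSubgroup M (p ++ [l])
      rwa [wordProd_append, wordProd_cons, wordProd_nil, mul_one, ← one_mul (wordProd M p)] at this

theorem inter_nbhd_orbit_nonempty (H : FourPoint X) {c ℓ : ℝ}
    (V : VisitsOrbit x M Set.univ (c + 8) ℓ) {u : G} (hu : u ∈ tupleSubgroup M) {R S : Set X}
    (hR : IsGeodesicSegment R x (u • x)) {p q : X} (hS : IsGeodesicSegment S p q) (hSR : S ⊆ R)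
    (hℓ : ℓ ≤ dist p q) :
    (S ∩ nbhd (⨆ i, (displacement x (M i) / 2 - c))
      (MulAction.orbit (tupleSubgroup M) x)).Nonempty := by
  obtain ⟨w, hw, rfl⟩ := exists_reduced_of_mem hu
  have main : ∀ p q, IsGeodesicSegment S p q →
      dist x p + dist p q + dist q (wordProd M w • x) ≤ dist x (wordProd M w • x) →
      ℓ ≤ dist p q → (S ∩ nbhd (⨆ i, (displacement x (M i) / 2 - c))
        (MulAction.orbit (tupleSubgroup M) x)).Nonempty := by
    intro p q hS hpq hℓ
    obtain ⟨z, hz, v, hv, i, -, hd⟩ := V 1 w hw p q (by rwa [one_mul, one_smul]) hℓ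
    have hz0 := dist_nonneg (x := z) (y := q)
    obtain ⟨y, hy, hpy⟩ := hS.exists_mem_dist_eq (t := dist p z)
      ⟨dist_nonneg, by unfold excess at hz; linarith⟩
    have hyq := hS.dist_add hy
    -- The point `z` lies on some geodesic from `p` to `q`, not necessarily on `S`; replacing it by
    -- the point of `S` at the same distance from `p` uses up the extra 8 in `V`.
    have hyz : dist y z ≤ 8 := H.dist_le_of_fellow (q := q) (by unfold excess; linarith) hz hpy
      (by rw [excess_self, dist_comm q p]; linarith [dist_nonneg (x := y) (y := q)])
    rw [subtupleSubgroup_univ] at hv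
    refine ⟨y, hy, v • x, smul_mem_orbit hv, ?_⟩
    have h1 : displacement x (M i) / 2 - c ≤ ⨆ i, (displacement x (M i) / 2 - c) :=
      le_ciSup (f := fun i => displacement x (M i) / 2 - c) (Set.finite_range _).bddAbove i
    have h2 := dist_triangle y z (v • x)
    rw [one_mul] at hd
    linarith
  rcases hR.dist_add_add (hSR hS.left_mem) (hSR hS.right_mem) with h | h
  · exact main p q hS h hℓ
  · exact main q p hS.symm h (by rwa [dist_comm])

end Conclusions

end HypAction

theorem theorem11 (n : ℕ) (hn : 0 < n) :
    -- `d₂, d₃` depend only on `n`, while `d₁, d₄` depend on `n` and `c`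
    ∃ d₂ d₃ : ℕ, 0 < d₂ ∧ 0 < d₃ ∧ ∀ c : ℝ, 0 < c → ∃ d₁ d₄ : ℕ, 0 < d₁ ∧ 0 < d₄ ∧
      ∀ (X : Type*) [MetricSpace X] (G : Type*) [Group G] [MulAction G X] [IsIsometricSMul G X],
        IsHyperbolicSpace X 1 →
        ∀ (x : X) (M : Fin n → G), IsMinimalTuple x M →
          (∃ M' : Fin n → G, NielsenEquiv M M' ∧ translationLength X (M' ⟨0, hn⟩) ≤ d₁) ∨
          (FreelyGenerates M ∧
            -- (1) the orbit map is a quasi-isometric embedding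
            IsQuasiIsometricEmbedding (wordDist M)
              (fun u : tupleSubgroup M => (u : G) • x) ∧
            -- (2) `[x, ux]` is close to the path of generator segments
            (∀ w : List (Fin n × Bool), w ≠ [] →
              ∀ S : Set X, IsGeodesicSegment S x (wordProd M w • x) →
              ∀ T : Fin w.length → Set X,
                (∀ j, IsGeodesicSegment (T j) x (letterVal M (w.get j) • x)) →
                S ⊆ nbhd d₂ (concatPath M w T)) ∧
            -- (2, continued) `[x, ux]` is close to the orbit `Ux`
            (∀ u ∈ tupleSubgroup M, ∀ S : Set X, IsGeodesicSegment S x (u • x) →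
              S ⊆ nbhd (⨆ i, (displacement x (M i) / 2 + d₂))
                (MulAction.orbit (tupleSubgroup M) x)) ∧
            -- (3) lower bound for the displacement of a freely reduced word
            (∀ w : List (Fin n × Bool), FreeGroup.IsReduced w → ∀ l ∈ w,
              displacement x (M l.1) - d₃ ≤ displacement x (wordProd M w)) ∧
            -- (4) every long subsegment `S` of `[x, ux]` comes close to the orbit `Ux`
            (∀ u ∈ tupleSubgroup M, ∀ R : Set X, IsGeodesicSegment R x (u • x) →
              ∀ (S : Set X) (p q : X), IsGeodesicSegment S p q → S ⊆ R → d₄ < dist p q →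
                (S ∩ nbhd (⨆ i, (displacement x (M i) / 2 - c))
                  (MulAction.orbit (tupleSubgroup M) x)).Nonempty)) := by
  obtain ⟨A, B, hA, hconst⟩ := exists_constants n n
  refine ⟨⌈A / 2 + 4⌉₊ + 1, ⌈B⌉₊ + 1, by omega, by omega, fun c hc => ?_⟩
  obtain ⟨ℓ, -, hconst⟩ := hconst (c + 8) (by linarith)
  -- Any positive lower bound on the displacement of nonempty reduced words suffices for freeness.
  obtain ⟨d, hconst⟩ := hconst 1
  refine ⟨⌈d⌉₊ + 1, ⌈ℓ⌉₊ + 1, by omega, by omega, ?_⟩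
  intro X _ G _ _ _ hX x M hM
  by_cases hshort : ∃ M' : Fin n → G, NielsenEquiv M M' ∧
      translationLength X (M' ⟨0, hn⟩) ≤ ((⌈d⌉₊ + 1 : ℕ) : ℝ)
  · exact Or.inl hshort
  right
  push Not at hshort
  have D : Dispersed x M d := (hM.dispersed hn hshort).mono
    ((Nat.le_ceil d).trans (by exact_mod_cast Nat.le_succ _))
  obtain ⟨T, Dom, V, P, Lin⟩ :=
    hconst X G hX.fourPoint hX.1.hasBetween x M D Finset.univ (by simp)
  rw [Finset.coe_univ] at T Dom V P Lin
  have hd₂ : A / 2 + 4 ≤ ((⌈A / 2 + 4⌉₊ + 1 : ℕ) : ℝ) :=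
    (Nat.le_ceil _).trans (by exact_mod_cast Nat.le_succ _)
  have hd₃ : B ≤ ((⌈B⌉₊ + 1 : ℕ) : ℝ) :=
    (Nat.le_ceil _).trans (by exact_mod_cast Nat.le_succ _)
  have hd₄ : ℓ ≤ ((⌈ℓ⌉₊ + 1 : ℕ) : ℝ) :=
    (Nat.le_ceil _).trans (by exact_mod_cast Nat.le_succ _)
  refine ⟨freelyGenerates_of_movesPoints x one_pos P,
    isQuasiIsometricEmbedding_of_linearGrowth Lin, ?_, ?_, ?_, ?_⟩
  · intro w hw S hS I hI
    exact mem_nbhd_concatPath hX.fourPoint hA hd₂ T hw hS hI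
  · intro u hu S hS
    exact mem_nbhd_orbit hn hA (by linarith) T hu hS
  · intro w hw l hl
    linarith [Dom w (reducedOver_univ hw) l hl]
  · intro u hu R hR S p q hS hSR hlen
    exact inter_nbhd_orbit_nonempty hX.fourPoint V hu hR hS hSR (hd₄.trans hlen.le)
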